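/- **Setting.** Let $M=(\mathcal S,\mathcal A,p,r,H)$ be a finite-horizon MDP with $S=|\mathcal S|$ states, $A=|\mathcal A|$ actions, transition probabilities $p(\cdot\mid s,a)$ and reward distributions supported in $[0,1]$ with means $r(s,a)$. For a Markov randomized policy $\pi=(d_1,\dots,d_H)$ let $V^\pi_h(s)=\mathbb E^\pi[\sum_{l=h}^H r(s_l,a_l)\mid s_h=s]$ and $V^\star_h=\sup_\pi V_h^\pi$. Let $\pi_b$ be a Markov randomized baseline policy whose value $V^{\pi_b}_1$ is known and for which $r_b:=\min_s V_1^{\pi_b}(s)>0$. Put $\underline\Delta_b:=\min_s\{V_1^\star(s)-V_1^{\pi_b}(s)\}$. Let $\alpha\in(0,1)$, $\delta>0$, $K\in\mathbb N$ and $L_K:=\max\{\ln(3KHSA/\delta),1\}$. The starting state $s_{k,1}$ of episode $k$ is chosen arbitrarily, possibly at random and depending on all previous episodes, and is revealed at the beginning of the episode. **Algorithms.** From the history $\mathcal H$ collected before episode $k$, let $N_k(s,a)$, $\hat r_k(s,a)$, $\hat p_k(\cdot\mid s,a)$ be the visit counts, empirical mean rewards and empirical transition frequencies (the last two are $0$ if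 $N_k(s,a)=0$), and let $$b_k(s,a)=H\sqrt{\frac{2S L_K}{\max\{1,N_k(s,a)\}}}+2\sqrt{\frac{L_K}{\max\{1,N_k(s,a)\}}}.$$ *UCB-VI* computes, with $\bar Q_{0,h}\equiv H$, $\bar v_{k,H+1}\equiv0$, by backward induction $$\bar Q_{k,h}(s,a)=\min\{\bar Q_{k-1,h}(s,a),\,H,\,\hat r_k(s,a)+b_k(s,a)+\hat p_k(\cdot\mid s,a)^{\mathsf T}\bar v_{k,h+1}\},\qquad \bar v_{k,h}(s)=\max_a\bar Q_{k,h}(s,a),$$ and proposes the policy $\tilde\pi_k$ that is greedy with respect to $\bar Q_{k,h}$ (ties broken by any fixed measurable rule). UCB-VI executes $\pi_k=\tilde\pi_k$ in every episode and adds the trajectory to $\mathcal H$. For a policy $\pi=(d_1,\dots,d_H)$ the pessimistic value is $\underline v^\pi_{k,H+1}\equiv 0$, $$\underline v^\pi_{k,h}(s)=\max\Big\{0,\ \sum_a d_h(a\mid s)\big(\hat r_k(s,a)-b_k(s,a)+\hat p_k(\cdot\mid s,a)^{\mathsf T}\underline v^\pi_{k,h+1}\big)\Big\}.$$ *CUCB-VI*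 executes $\pi_k=\tilde\pi_k$ in episode $k$ and adds the trajectory to $\mathcal H$ if $$\sum_{l\in\mathcal S_{k-1}\cup\{k\}}\underline v_{l,1}^{\tilde\pi_l}(s_{l,1})+\sum_{l\in\mathcal S^c_{k-1}}V_1^{\pi_b}(s_{l,1})\ \ge\ (1-\alpha)\sum_{l=1}^kV_1^{\pi_b}(s_{l,1}),$$ where $\mathcal S_{k-1}$ is the set of earlier episodes in which it executed its proposal and $\mathcal S_{k-1}^c=\{1,\dots,k-1\}\setminus\mathcal S_{k-1}$; otherwise it executes $\pi_k=\pi_b$ (a conservative episode) and leaves $\mathcal H$ unchanged. The regret of an algorithm is $R(\cdot,K)=\sum_{k=1}^K\big(V_1^\star(s_{k,1})-V_1^{\pi_k}(s_{k,1})\big)$. The two algorithms are compared on the same randomness: the $j$-th non-conservative episode of CUCB-VI and the $j$-th episode of UCB-VI draw rewards and next states from the same independent samples. $R(\text{UCB-VI},K)$ is the regret of $K$ episodes of UCB-VI whose starting states begin with those of the non-conservative episodes of CUCB-VI among the first $K$, in the same order, and continue arbitrarily; if all episodes start in one fixed state, it is simply the regret of UCB-VI from that state. **Proposition.** With probability at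 least $1-\delta$, all of the following hold simultaneously: 1. (for all such continuations) $$R(\text{CUCB-VI},K)\le R(\text{UCB-VI},K)+\frac{16H^3L_K+\big(200H^5S^2A+128H^5SA\big)L_K^2}{4\alpha r_b(\underline\Delta_b+\alpha r_b)};$$ 2. the number of conservative episodes among the first $K$ is logarithmic in $K$: $$|\mathcal S_K^c|\le\frac{16H^3L_K+\big(200H^5S^2A+128H^5SA\big)L_K^2}{4\alpha r_b(\underline\Delta_b+\alpha r_b)};$$ 3. the conservative condition holds: $\sum_{l=1}^kV_1^{\pi_l}(s_{l,1})\ge(1-\alpha)\sum_{l=1}^kV_1^{\pi_b}(s_{l,1})$ for all $k\in\{1,\dots,K\}$. -/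

import Mathlib

open MeasureTheory
open scoped Classical

noncomputable section

namespace ConservativeRL

/-- A finite-horizon Markov decision process with stationary transitions `p(· | s, a)` and
stationary reward distributions supported in `[0, 1]`.  The `H` steps of an episode are numbered
`0, …, H - 1`. -/
structure MDP (S A : Type*) where
  horizon : ℕ
  trans : S → A → PMF S
  rewardLaw : S → A → Measure ℝ
  rewardLaw_prob : ∀ s a, IsProbabilityMeasure (rewardLaw s a)
  rewardLaw_support : ∀ s a, ∀ᵐ x ∂(rewardLaw s a), x ∈ Set.Icc (0 : ℝ) 1

attribute [instance] MDP.rewardLaw_prob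

/-- A Markov randomized policy: one randomized decision rule for every step of the episode
(only the steps `h < H` matter). -/
abbrev Policy (S A : Type*) := ℕ → S → PMF A

/-- A deterministic Markov policy, seen as a randomized one. -/
def Policy.ofDet {S A : Type*} (d : ℕ → S → A) : Policy S A := fun h s => PMF.pure (d h s)

/-! ### Value functions -/

section Values

variable {S A : Type*} [Fintype S] [Fintype A]

/-- The mean reward `r(s, a)`. -/
def MDP.meanReward (M : MDP S A) (s : S) (a : A) : ℝ := ∫ x, x ∂(M.rewardLaw s a)

/-- The law of the state at step `t + i` when `π` is followed from state `s` at step `t`. -/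
def MDP.stateLaw (M : MDP S A) (π : Policy S A) (t : ℕ) (s : S) : ℕ → PMF S
  | 0 => PMF.pure s
  | i + 1 => (M.stateLaw π t s i).bind fun x => (π (t + i) x).bind fun a => M.trans x a

/-- The value `V^π_t(s) = 𝔼^π [∑_{l = t}^{H - 1} r(s_l, a_l) | s_t = s]`. -/
def MDP.value (M : MDP S A) (π : Policy S A) (t : ℕ) (s : S) : ℝ :=
  ∑ i ∈ Finset.range (M.horizon - t),
    ∑ x, (M.stateLaw π t s i x).toReal *
      ∑ a, (π (t + i) x a).toReal * M.meanReward x a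

/-- The optimal value `V*_t(s) = sup_π V^π_t(s)`. -/
def MDP.optValue (M : MDP S A) (t : ℕ) (s : S) : ℝ := ⨆ π : Policy S A, M.value π t s

/-- `r_b = min_s V^{π_b}_1(s)`. -/
def MDP.baselineMin (M : MDP S A) (πb : Policy S A) : ℝ := ⨅ s, M.value πb 0 s

/-- `Δ_b = min_s (V*_1(s) - V^{π_b}_1(s))`. -/
def MDP.baselineGap (M : MDP S A) (πb : Policy S A) : ℝ :=
  ⨅ s, (M.optValue 0 s - M.value πb 0 s)

end Values

/-! ### Observed data and the estimates built from them -/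

/-- One observed step `(s_h, a_h, r_h, s_{h+1})`. -/
abbrev Transition (S A : Type*) := S × A × ℝ × S

/-- The record of one episode: its starting state, whether the optimistic policy was executed
(`true`) or the baseline (`false`), and the trajectory. -/
abbrev Record (S A : Type*) (H : ℕ) := (S × Bool) × (Fin H → Transition S A)

/-- The starting state of an episode. -/
def Record.start {S A : Type*} {H : ℕ} (e : Record S A H) : S := e.1.1

/-- Whether the episode was non-conservative. -/
def Record.explored {S A : Type*} {H : ℕ} (e : Record S A H) : Bool := e.1.2

section Estimates

variable {S A : Type*} [Fintype S] [Fintype A] {H k : ℕ}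

/-- The number of visits of `(s, a)` in the non-conservative episodes among the first `k`. -/
def visits (past : Fin k → Record S A H) (s : S) (a : A) : ℕ :=
  ∑ l, ∑ h, if Record.explored (past l) = true ∧
    ((past l).2 h).1 = s ∧ ((past l).2 h).2.1 = a then 1 else 0

/-- The number of observed transitions `(s, a) → s'` in the non-conservative episodes. -/
def transitionCount (past : Fin k → Record S A H) (s : S) (a : A) (s' : S) : ℕ :=
  ∑ l, ∑ h, if Record.explored (past l) = true ∧
    ((past l).2 h).1 = s ∧ ((past l).2 h).2.1 = a ∧ ((past l).2 h).2.2.2 = s' then 1 else 0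

/-- The sum of the rewards observed in `(s, a)` in the non-conservative episodes. -/
def rewardSum (past : Fin k → Record S A H) (s : S) (a : A) : ℝ :=
  ∑ l, ∑ h, if Record.explored (past l) = true ∧
    ((past l).2 h).1 = s ∧ ((past l).2 h).2.1 = a then ((past l).2 h).2.2.1 else 0

/-- The empirical transition probabilities (`0` at a pair that was never visited). -/
def empTrans (past : Fin k → Record S A H) (s : S) (a : A) (s' : S) : ℝ :=
  (transitionCount past s a s' : ℝ) / (visits past s a : ℝ)

/-- The empirical mean rewards (`0` at a pair that was never visited). -/
def empReward (past : Fin k → Record S A H) (s : S) (a : A) : ℝ :=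
  rewardSum past s a / (visits past s a : ℝ)

/-- `β^p(s, a) + β^r(s, a)`, with `β^p = H √(2 S L / max(1, N))` and `β^r = 2 √(L / max(1, N))`,
where `L` is the confidence level on the logarithmic scale. -/
def bonus (L : ℝ) (past : Fin k → Record S A H) (s : S) (a : A) : ℝ :=
  (H : ℝ) * Real.sqrt (2 * (Fintype.card S : ℝ) * L / max 1 (visits past s a : ℝ)) +
    2 * Real.sqrt (L / max 1 (visits past s a : ℝ))

/-- One optimistic backward induction.  The first explicit natural number of the result is the
number `n` of steps to go; `prev` is the `Q`-function of the previous episode. -/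
def optBackup (L : ℝ) (prev : ℕ → S → A → ℝ) (past : Fin k → Record S A H) : ℕ → S → A → ℝ
  | 0 => fun _ _ => 0
  | n + 1 => fun s a =>
      min (prev (n + 1) s a) (min (H : ℝ)
        (empReward past s a + bonus L past s a +
          ∑ s', empTrans past s a s' * ⨆ a', optBackup L prev past n s' a'))

/-- The optimistic `Q`-function of UCB-VI computed after `k` episodes:
`Q_k = min {Q_{k-1}, H, r̂ + b + p̂ᵀ max_a Q_k(·, a)}`, indexed by the number of steps to go. -/
def optQ (L : ℝ) : (k : ℕ) → (Fin k → Record S A H) → ℕ → S → A → ℝ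
  | 0, past => optBackup L (fun _ _ _ => (H : ℝ)) past
  | k + 1, past => optBackup L (optQ L k fun i => past i.castSucc) past

/-- The decision rules of UCB-VI: greedy with respect to the optimistic `Q`-function, the ties
being broken by `sel`. -/
def ucbviAction (L : ℝ) (sel : (A → ℝ) → A) (past : Fin k → Record S A H) (h : ℕ) (s : S) : A :=
  sel (optQ L k past (H - h) s)

/-- The policy proposed by UCB-VI after the first `k` episodes. -/
def ucbviPolicy (L : ℝ) (sel : (A → ℝ) → A) (past : Fin k → Record S A H) : Policy S A :=
  Policy.ofDet (ucbviAction L sel past)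

/-- The pessimistic evaluation of a policy, truncated at `0`, indexed by the number of steps
to go. -/
def pessValue (L : ℝ) (past : Fin k → Record S A H) (π : Policy S A) : ℕ → S → ℝ
  | 0 => fun _ => 0
  | n + 1 => fun s => max 0
      (∑ a, (π (H - (n + 1)) s a).toReal *
        (empReward past s a - bonus L past s a +
          ∑ s', empTrans past s a s' * pessValue L past π n s'))

/-- The pessimistic value of UCB-VI's proposal at the first step of an episode started in `s`. -/
def pessProposal (L : ℝ) (sel : (A → ℝ) → A) (past : Fin k → Record S A H) (s : S) : ℝ :=
  pessValue L past (ucbviPolicy L sel past) H s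

/-- The condition that CUCB-VI checks before the episode that follows the first `k` ones and
starts in `s`; `Vb` is the value function of the baseline at the first step. -/
def safetyTest (L α : ℝ) (sel : (A → ℝ) → A) (Vb : S → ℝ) (k : ℕ)
    (past : Fin k → Record S A H) (s : S) : Prop :=
  (1 - α) * (∑ l, Vb (Record.start (past l)) + Vb s) ≤
    (∑ l : Fin k,
      if Record.explored (past l) = true then
        pessProposal L sel (fun i : Fin l.1 => past ⟨i.1, i.2.trans l.2⟩) (Record.start (past l))
      else Vb (Record.start (past l))) +
    pessProposal L sel past s

end Estimates

/-! ### The interaction with the environment -/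

/-- The randomness of one step: an action for every state (drawn from the baseline and used only in
conservative episodes), and a reward and a next state for every state-action pair. -/
abbrev StepNoise (S A : Type*) := (S → A) × (S → A → ℝ × S)

/-- All randomness of the environment.  The block `(true, j, ·)` feeds the `j`-th episode in which
the optimistic policy is executed, the block `(false, j, ·)` the `j`-th conservative episode. -/
abbrev Noise (S A : Type*) := Bool × ℕ × ℕ → StepNoise S A

section Interaction

variable {S A : Type*} [Fintype S] [MeasurableSpace S] [Fintype A] [MeasurableSpace A]

/-- The law of the randomness of step `h`: everything is independent, actions follow the baseline,
rewards the reward distributions and next states the transition probabilities. -/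
def stepLaw (M : MDP S A) (πb : Policy S A) (h : ℕ) : Measure (StepNoise S A) :=
  (Measure.pi fun s => (πb h s).toMeasure).prod
    (Measure.pi fun s => Measure.pi fun a => (M.rewardLaw s a).prod (M.trans s a).toMeasure)

instance stepLaw_prob (M : MDP S A) (πb : Policy S A) (h : ℕ) :
    IsProbabilityMeasure (stepLaw M πb h) := by
  unfold stepLaw
  infer_instance

/-- The law of the environment's randomness: independent steps. -/
def noiseLaw (M : MDP S A) (πb : Policy S A) : Measure (Noise S A) :=
  Measure.infinitePi fun i : Bool × ℕ × ℕ => stepLaw M πb i.2.2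

instance noiseLaw_prob (M : MDP S A) (πb : Policy S A) :
    IsProbabilityMeasure (noiseLaw M πb) := by
  unfold noiseLaw
  infer_instance

end Interaction

section Episodes

variable {S A : Type*} [Fintype S] [Fintype A]

/-- The states visited in an episode started in `s`, when actions are chosen by `act`. -/
def rollout (act : ℕ → StepNoise S A → S → A) (ν : ℕ → StepNoise S A) (s : S) : ℕ → S
  | 0 => s
  | h + 1 => ((ν h).2 (rollout act ν s h) (act h (ν h) (rollout act ν s h))).2

/-- The trajectory of an episode. -/
def trajectory (H : ℕ) (act : ℕ → StepNoise S A → S → A) (ν : ℕ → StepNoise S A) (s : S) :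
    Fin H → Transition S A := fun h =>
  let x := rollout act ν s h
  let a := act h (ν h) x
  (x, a, (ν h).2 x a)

/-- The number of episodes with flag `b` among the first `k`. -/
def countFlag {H k : ℕ} (past : Fin k → Record S A H) (b : Bool) : ℕ :=
  (Finset.univ.filter fun l => Record.explored (past l) = b).card

/-- The episodes generated when UCB-VI's proposal is executed in the episodes in which `rule`
holds, and the baseline (whose actions are part of the noise) in the other ones.  Both `rule` and
the choice `start` of the starting state see the past only. -/
def episode (H : ℕ) (L : ℝ) (sel : (A → ℝ) → A)
    (rule : (k : ℕ) → (Fin k → Record S A H) → S → Prop)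
    (start : (k : ℕ) → (Fin k → Record S A H) → S) (ω : Noise S A) (k : ℕ) : Record S A H :=
  let past : Fin k → Record S A H := fun l => episode H L sel rule start ω l.1
  let s := start k past
  let b : Bool := decide (rule k past s)
  let act : ℕ → StepNoise S A → S → A := fun h ν x =>
    if b = true then ucbviAction L sel past h x else ν.1 x
  ((s, b), trajectory H act (fun h => ω (b, countFlag past b, h)) s)
termination_by k
decreasing_by exact l.2

/-- UCB-VI: its proposal is executed in every episode. -/
def ucbvi (M : MDP S A) (L : ℝ) (sel : (A → ℝ) → A)
    (start : (k : ℕ) → (Fin k → Record S A M.horizon) → S) (ω : Noise S A) :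
    ℕ → Record S A M.horizon :=
  episode M.horizon L sel (fun _ _ _ => True) start ω

/-- CUCB-VI: UCB-VI's proposal is executed when it passes the safety test, otherwise the
baseline `πb` is. -/
def cucbvi (M : MDP S A) (πb : Policy S A) (L α : ℝ) (sel : (A → ℝ) → A)
    (start : (k : ℕ) → (Fin k → Record S A M.horizon) → S) (ω : Noise S A) :
    ℕ → Record S A M.horizon :=
  episode M.horizon L sel (safetyTest L α sel (M.value πb 0)) start ω

/-- The policy executed in episode `k` (counted from `0`) of a run. -/
def executed {H : ℕ} (πb : Policy S A) (L : ℝ) (sel : (A → ℝ) → A) (e : ℕ → Record S A H)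
    (k : ℕ) : Policy S A :=
  if Record.explored (e k) = true then ucbviPolicy L sel (fun l : Fin k => e l) else πb

/-- The regret `∑_{k < K} (V*_1(s_{k,1}) - V^{π_k}_1(s_{k,1}))` of a run. -/
def regret (M : MDP S A) (πb : Policy S A) (L : ℝ) (sel : (A → ℝ) → A)
    (e : ℕ → Record S A M.horizon) (K : ℕ) : ℝ :=
  ∑ k ∈ Finset.range K, (M.optValue 0 (Record.start (e k)) -
    M.value (executed πb L sel e k) 0 (Record.start (e k)))

/-- `L_K = max {ln (3 K H S A / δ), 1}`. -/
def logTerm (M : MDP S A) (K : ℕ) (δ : ℝ) : ℝ :=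
  max (Real.log (3 * K * M.horizon * Fintype.card S * Fintype.card A / δ)) 1

/-- `(16 H³ L + (200 H⁵ S² A + 128 H⁵ S A) L²) / (4 α r_b (Δ_b + α r_b))`. -/
def conservativeCost (M : MDP S A) (πb : Policy S A) (α L : ℝ) : ℝ :=
  (16 * (M.horizon : ℝ) ^ 3 * L +
      (200 * (M.horizon : ℝ) ^ 5 * (Fintype.card S : ℝ) ^ 2 * (Fintype.card A : ℝ) +
        128 * (M.horizon : ℝ) ^ 5 * (Fintype.card S : ℝ) * (Fintype.card A : ℝ)) * L ^ 2) /
    (4 * α * M.baselineMin πb * (M.baselineGap πb + α * M.baselineMin πb))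

end Episodes

end ConservativeRL

end

set_option linter.unusedSectionVars false

/-! Probability enters through a single event, `GoodRun`: up to episode `K` all empirical rewards
and transition frequencies lie in their confidence sets, and the martingale comparing expected with
observed next-state gaps is small. On this event everything is deterministic.

Optimistic values dominate the value of every policy (`le_optQ`) and pessimistic evaluations stay
below it (`pessValue_le_value`). For the greedy policy the difference of the two unrolls along the
observed trajectory into confidence widths plus martingale noise
(`confidenceGap_succ_le_visitCost`). A width decays like the inverse square root of the visit count,
so a pigeonhole argument bounds the total gap of `n` non-conservative episodes by `g √n`
(`GoodRun.sum_confidenceGap_le`).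

Put `D = Δ_b + α r_b`. Measured against the level `(1 - α) V_b`, the safety test credits a
non-conservative episode with a surplus of at least `D` minus its gap, and a conservative one with
at least `α r_b`. Rejection at the last conservative episode says that the accumulated surplus is
still small, so the number `N` of conservative episodes satisfies `α r_b N ≤ g √n - D n + H ≤ g² /
(4 D) + H`. This bounds `N`, and even `H N` fits under the stated cost
(`GoodRun.horizon_mul_countFlag_le`). The conservative condition holds because accepted proposals
are credited with lower bounds of their true values.

The regret comparison is pathwise (`coupling`). Conservative episodes leave the data unchanged, and
repeating a backup on unchanged data leaves the `Q`-function unchanged, so the `j`-th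
non-conservative episode coincides with the `j`-th episode of UCB-VI. Each conservative episode adds
at most `H` to the regret.

The probability of `GoodRun` is estimated without filtrations or conditional expectations. Redrawing
one coordinate of the product noise preserves its law. With noise ordered by non-conservative
episode and step, this makes the exponentials of Hoeffding-compensated sums supermartingales.
Ville's inequality (`measure_exists_le_sum_le_exp`) then controls all episodes at once, and the
union bound runs only over counts, pairs, subsets of states and signs. -/

namespace ConservativeRL

/-! ### Value functions and the Bellman equation of a policy -/

section Values

variable {S A : Type*} [Fintype S] [Fintype A]

/-- The expectation of a function under a probability mass function on a finite type. -/
noncomputable def pmfMean {α : Type*} [Fintype α] (p : PMF α) (f : α → ℝ) : ℝ :=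
  ∑ x, (p x).toReal * f x

lemma pmf_sum_toReal {α : Type*} [Fintype α] (p : PMF α) : ∑ x, (p x).toReal = 1 := by
  rw [← ENNReal.toReal_sum fun x _ => p.apply_ne_top x, ← tsum_fintype (L := .unconditional _),
    p.tsum_coe, ENNReal.toReal_one]

lemma pmfMean_mono {α : Type*} [Fintype α] (p : PMF α) {f g : α → ℝ} (h : ∀ x, f x ≤ g x) :
    pmfMean p f ≤ pmfMean p g :=
  Finset.sum_le_sum fun x _ => mul_le_mul_of_nonneg_left (h x) ENNReal.toReal_nonneg

lemma pmfMean_const {α : Type*} [Fintype α] (p : PMF α) (c : ℝ) : pmfMean p (fun _ => c) = c := by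
  rw [pmfMean, ← Finset.sum_mul, pmf_sum_toReal, one_mul]

lemma pmfMean_pure {α : Type*} [Fintype α] (x : α) (f : α → ℝ) : pmfMean (PMF.pure x) f = f x := by
  unfold pmfMean
  rw [Finset.sum_eq_single x]
  · simp
  · intro y _ hy
    simp [PMF.pure_apply, hy]
  · simp

lemma pmfMean_bind {α β : Type*} [Fintype α] [Fintype β] (p : PMF α) (q : α → PMF β) (f : β → ℝ) :
    pmfMean (p.bind q) f = pmfMean p fun x => pmfMean (q x) f := by
  unfold pmfMean
  simp only [PMF.bind_apply, tsum_fintype]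
  have : ∀ y, (∑ x, p x * q x y).toReal = ∑ x, (p x).toReal * (q x y).toReal := by
    intro y
    rw [ENNReal.toReal_sum fun x _ => ENNReal.mul_ne_top (p.apply_ne_top x) ((q x).apply_ne_top y)]
    simp
  simp only [this, Finset.sum_mul, Finset.mul_sum]
  rw [Finset.sum_comm]
  simp only [mul_assoc]

lemma pmfMean_add {α : Type*} [Fintype α] (p : PMF α) (f g : α → ℝ) :
    pmfMean p (fun x => f x + g x) = pmfMean p f + pmfMean p g := by
  simp [pmfMean, mul_add, Finset.sum_add_distrib]

lemma pmfMean_sum {α ι : Type*} [Fintype α] (p : PMF α) (s : Finset ι) (f : ι → α → ℝ) :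
    pmfMean p (fun x => ∑ i ∈ s, f i x) = ∑ i ∈ s, pmfMean p (f i) := by
  simp only [pmfMean, Finset.mul_sum]
  rw [Finset.sum_comm]

variable (M : MDP S A) (π : Policy S A)

lemma MDP.meanReward_nonneg (s : S) (a : A) : 0 ≤ M.meanReward s a :=
  integral_nonneg_of_ae ((M.rewardLaw_support s a).mono fun _ h => h.1)

lemma MDP.meanReward_le_one (s : S) (a : A) : M.meanReward s a ≤ 1 := by
  have h : ∫ x, x ∂(M.rewardLaw s a) ≤ ∫ _, (1 : ℝ) ∂(M.rewardLaw s a) :=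
    integral_mono_ae (Integrable.of_mem_Icc 0 1 aemeasurable_id (M.rewardLaw_support s a))
      (integrable_const _) ((M.rewardLaw_support s a).mono fun _ h => h.2)
  simpa [MDP.meanReward] using h

/-- The law of the state is defined by appending a last step; the Bellman equation needs the first
step split off instead. -/
lemma MDP.stateLaw_succ (t : ℕ) (s : S) (i : ℕ) :
    M.stateLaw π t s (i + 1) =
      (π t s).bind fun a => (M.trans s a).bind fun y => M.stateLaw π (t + 1) y i := by
  induction i with
  | zero => simp [MDP.stateLaw]
  | succ i ih =>
    rw [MDP.stateLaw, ih]
    simp only [PMF.bind_bind, MDP.stateLaw]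
    simp only [add_assoc, add_comm 1 i]

lemma MDP.value_eq (t : ℕ) (s : S) :
    M.value π t s = ∑ i ∈ Finset.range (M.horizon - t),
      pmfMean (M.stateLaw π t s i) fun x => pmfMean (π (t + i) x) fun a => M.meanReward x a := rfl

lemma MDP.value_of_horizon_le {t : ℕ} (ht : M.horizon ≤ t) (s : S) : M.value π t s = 0 := by
  simp [MDP.value_eq, Nat.sub_eq_zero_of_le ht]

lemma MDP.value_bellman {t : ℕ} (ht : t < M.horizon) (s : S) :
    M.value π t s = pmfMean (π t s) fun a =>
      M.meanReward s a + pmfMean (M.trans s a) (M.value π (t + 1)) := by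
  rw [MDP.value_eq, show M.horizon - t = (M.horizon - (t + 1)) + 1 by omega,
    Finset.sum_range_succ', add_comm, pmfMean_add]
  congr 1
  · simp [MDP.stateLaw, pmfMean_pure]
  · simp only [MDP.stateLaw_succ, pmfMean_bind]
    rw [← pmfMean_sum]
    congr 1
    funext a
    rw [← pmfMean_sum]
    congr 1
    funext y
    rw [MDP.value_eq]
    simp only [add_assoc, add_comm 1]

lemma MDP.value_nonneg (t : ℕ) (s : S) : 0 ≤ M.value π t s := by
  rw [MDP.value_eq]
  refine Finset.sum_nonneg fun i _ => ?_
  rw [← pmfMean_const (M.stateLaw π t s i) 0]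
  refine pmfMean_mono _ fun x => ?_
  rw [← pmfMean_const (π (t + i) x) 0]
  exact pmfMean_mono _ fun a => M.meanReward_nonneg x a

lemma MDP.value_le (t : ℕ) (s : S) : M.value π t s ≤ (M.horizon - t : ℕ) := by
  have h : M.value π t s ≤ ∑ i ∈ Finset.range (M.horizon - t), (1 : ℝ) := by
    rw [MDP.value_eq]
    refine Finset.sum_le_sum fun i _ => ?_
    rw [← pmfMean_const (M.stateLaw π t s i) 1]
    refine pmfMean_mono _ fun x => ?_
    rw [← pmfMean_const (π (t + i) x) 1]
    exact pmfMean_mono _ fun a => M.meanReward_le_one x a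
  simpa using h

lemma MDP.value_le_horizon (t : ℕ) (s : S) : M.value π t s ≤ M.horizon :=
  (M.value_le π t s).trans (Nat.cast_le.2 (Nat.sub_le _ _))

lemma MDP.value_le_optValue (t : ℕ) (s : S) : M.value π t s ≤ M.optValue t s :=
  le_ciSup (f := fun π => M.value π t s) ⟨M.horizon, by
    rintro _ ⟨π, rfl⟩
    exact M.value_le_horizon π t s⟩ π

lemma MDP.optValue_le [Nonempty A] {t : ℕ} {s : S} {c : ℝ}
    (h : ∀ π : Policy S A, M.value π t s ≤ c) : M.optValue t s ≤ c := by
  have : Nonempty (Policy S A) := ⟨fun _ _ => PMF.pure (Classical.arbitrary A)⟩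
  exact ciSup_le h

lemma MDP.baselineMin_le (s : S) : M.baselineMin π ≤ M.value π 0 s :=
  ciInf_le (Set.finite_range _).bddBelow s

lemma MDP.baselineGap_le (s : S) : M.baselineGap π ≤ M.optValue 0 s - M.value π 0 s :=
  ciInf_le (Set.finite_range fun s => M.optValue 0 s - M.value π 0 s).bddBelow s

lemma MDP.baselineGap_nonneg [Nonempty S] : 0 ≤ M.baselineGap π :=
  le_ciInf fun s => sub_nonneg.2 (M.value_le_optValue π 0 s)

end Values

/-! ### Confidence sets, optimism, pessimism and the gap between them -/

section Confidence

variable {S A : Type*} [Fintype S] [Fintype A] {H : ℕ}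

/-- The first `k` episodes of a run. -/
abbrev history (e : ℕ → Record S A H) (k : ℕ) : Fin k → Record S A H := fun l => e l

/-- The half-width of the confidence interval for the mean reward. -/
noncomputable def rewardRadius (L : ℝ) (N : ℕ) : ℝ := 2 * Real.sqrt (L / max 1 (N : ℝ))

/-- The radius of the `ℓ¹` confidence ball for the transition probabilities. -/
noncomputable def transRadius (S : Type*) [Fintype S] (L : ℝ) (N : ℕ) : ℝ :=
  Real.sqrt (2 * (Fintype.card S : ℝ) * L / max 1 (N : ℝ))

lemma bonus_eq {k : ℕ} (L : ℝ) (past : Fin k → Record S A H) (s : S) (a : A) :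
    bonus L past s a =
      H * transRadius S L (visits past s a) + rewardRadius L (visits past s a) := rfl

/-- The empirical estimates lie in the confidence sets around the true model. -/
structure Concentrated (M : MDP S A) (L : ℝ) {k : ℕ} (past : Fin k → Record S A M.horizon) :
    Prop where
  reward : ∀ s a, |empReward past s a - M.meanReward s a| ≤ rewardRadius L (visits past s a)
  trans : ∀ s a, ∑ s', |empTrans past s a s' - (M.trans s a s').toReal| ≤
    transRadius S L (visits past s a)

lemma empTrans_nonneg {k : ℕ} (past : Fin k → Record S A H) (s : S) (a : A) (s' : S) :
    0 ≤ empTrans past s a s' := by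
  unfold empTrans
  positivity

lemma Concentrated.abs_trans_sub_le {M : MDP S A} {L : ℝ} {k : ℕ}
    {past : Fin k → Record S A M.horizon} (h : Concentrated M L past) (s : S) (a : A)
    {f : S → ℝ} {B : ℝ} (hf : ∀ x, |f x| ≤ B) :
    |∑ s', empTrans past s a s' * f s' - pmfMean (M.trans s a) f| ≤
      B * transRadius S L (visits past s a) := by
  have hB : 0 ≤ B := (abs_nonneg _).trans (hf s)
  unfold pmfMean
  rw [← Finset.sum_sub_distrib]
  calc |∑ s', (empTrans past s a s' * f s' - (M.trans s a s').toReal * f s')|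
      ≤ ∑ s', |empTrans past s a s' * f s' - (M.trans s a s').toReal * f s'| :=
        Finset.abs_sum_le_sum_abs _ _
    _ ≤ ∑ s', B * |empTrans past s a s' - (M.trans s a s').toReal| := by
        refine Finset.sum_le_sum fun s' _ => ?_
        rw [← sub_mul, abs_mul, mul_comm]
        exact mul_le_mul_of_nonneg_right (hf s') (abs_nonneg _)
    _ ≤ B * transRadius S L (visits past s a) := by
        rw [← Finset.mul_sum]
        exact mul_le_mul_of_nonneg_left (h.trans s a) hB

/-- The optimistic value function after `k` episodes with `n` steps to go. -/
noncomputable def optValueEstimate (L : ℝ) {k : ℕ} (past : Fin k → Record S A H) (n : ℕ) (s : S) :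
    ℝ := ⨆ a, optQ L k past n s a

variable [Nonempty A]

lemma optValueEstimate_zero {k : ℕ} (L : ℝ) (past : Fin k → Record S A H) (s : S) :
    optValueEstimate L past 0 s = 0 := by
  unfold optValueEstimate
  cases k <;> simp [optQ, optBackup]

/-- Each of the three terms in the minimum is an upper bound: the previous `Q` by hypothesis, `H`
because at most `n + 1` rewards remain, and the empirical backup because the bonus covers both
estimation errors. The comparison is with one fixed policy at a time, so no Bellman equation for the
optimal value is needed. -/
lemma le_optBackup {M : MDP S A} {L : ℝ} {k : ℕ} {past : Fin k → Record S A M.horizon}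
    (hc : Concentrated M L past) (π : Policy S A) {prev : ℕ → S → A → ℝ}
    (hprev : ∀ n < M.horizon, ∀ s a, M.meanReward s a +
      pmfMean (M.trans s a) (M.value π (M.horizon - n)) ≤ prev (n + 1) s a) :
    ∀ n < M.horizon, ∀ s a, M.meanReward s a +
      pmfMean (M.trans s a) (M.value π (M.horizon - n)) ≤
        optBackup L prev past (n + 1) s a := by
  have hval : ∀ n, (∀ s, M.value π (M.horizon - n) s ≤ ⨆ a, optBackup L prev past n s a) →
      n < M.horizon → ∀ s a, M.meanReward s a +
      pmfMean (M.trans s a) (M.value π (M.horizon - n)) ≤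
        optBackup L prev past (n + 1) s a := by
    intro n hn hnH s a
    refine le_min (hprev n hnH s a) (le_min ?_ ?_)
    · have h1 : pmfMean (M.trans s a) (M.value π (M.horizon - n)) ≤ n := by
        rw [← pmfMean_const (M.trans s a) (n : ℝ)]
        refine pmfMean_mono _ fun x => (M.value_le π _ x).trans ?_
        exact_mod_cast (by omega : M.horizon - (M.horizon - n) ≤ n)
      have h2 : (n : ℝ) + 1 ≤ M.horizon := by exact_mod_cast hnH
      linarith [M.meanReward_le_one s a]
    · have h1 := hc.abs_trans_sub_le s a (f := M.value π (M.horizon - n)) (B := M.horizon)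
        fun x => by
          rw [abs_of_nonneg (M.value_nonneg π _ x)]
          exact M.value_le_horizon π _ x
      have h2 : ∑ s', empTrans past s a s' * M.value π (M.horizon - n) s' ≤
          ∑ s', empTrans past s a s' * ⨆ a', optBackup L prev past n s' a' :=
        Finset.sum_le_sum fun s' _ =>
          mul_le_mul_of_nonneg_left (hn s') (empTrans_nonneg past s a s')
      have h3 := hc.reward s a
      rw [abs_le] at h1 h3
      rw [bonus_eq]
      linarith [h1.1, h3.1]
  intro n
  induction n with
  | zero =>
    refine hval 0 fun s => ?_
    simp [M.value_of_horizon_le π le_rfl, optBackup]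
  | succ n ih =>
    intro hn
    refine hval (n + 1) (fun s => ?_) hn
    rw [M.value_bellman π (by omega) s, show M.horizon - (n + 1) + 1 = M.horizon - n by omega,
      ← pmfMean_const (π (M.horizon - (n + 1)) s) (⨆ a, optBackup L prev past (n + 1) s a)]
    exact pmfMean_mono _ fun a => (ih (by omega) s a).trans
      (le_ciSup (Set.finite_range fun a => optBackup L prev past (n + 1) s a).bddAbove a)

/-- The `Q`-function is a running minimum over episodes, so optimism after `k` episodes needs
concentration of every earlier history as well. -/
lemma le_optQ {M : MDP S A} {L : ℝ} {e : ℕ → Record S A M.horizon} {k : ℕ}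
    (hc : ∀ j ≤ k, Concentrated M L (history e j)) (π : Policy S A) :
    ∀ n < M.horizon, ∀ s a, M.meanReward s a +
      pmfMean (M.trans s a) (M.value π (M.horizon - n)) ≤
        optQ L k (history e k) (n + 1) s a := by
  induction k with
  | zero =>
    refine le_optBackup (hc 0 le_rfl) π fun n hnH s a => ?_
    have h1 : pmfMean (M.trans s a) (M.value π (M.horizon - n)) ≤ n := by
      rw [← pmfMean_const (M.trans s a) (n : ℝ)]
      refine pmfMean_mono _ fun x => (M.value_le π _ x).trans ?_
      exact_mod_cast (by omega : M.horizon - (M.horizon - n) ≤ n)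
    have h2 : (n : ℝ) + 1 ≤ M.horizon := by exact_mod_cast hnH
    linarith [M.meanReward_le_one s a]
  | succ k ih =>
    exact le_optBackup (hc (k + 1) le_rfl) π (ih fun j hj => hc j (hj.trans (Nat.le_succ k)))

/-- Optimism: the optimistic value function dominates the value of every policy. -/
lemma value_le_optValueEstimate {M : MDP S A} {L : ℝ} {e : ℕ → Record S A M.horizon} {k : ℕ}
    (hc : ∀ j ≤ k, Concentrated M L (history e j)) (π : Policy S A) {n : ℕ} (hn : n ≤ M.horizon)
    (s : S) : M.value π (M.horizon - n) s ≤ optValueEstimate L (history e k) n s := by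
  cases n with
  | zero =>
    rw [Nat.sub_zero, M.value_of_horizon_le π le_rfl, optValueEstimate_zero]
  | succ n =>
    unfold optValueEstimate
    rw [M.value_bellman π (by omega) s, show M.horizon - (n + 1) + 1 = M.horizon - n by omega,
      ← pmfMean_const (π (M.horizon - (n + 1)) s) (⨆ a, optQ L k (history e k) (n + 1) s a)]
    exact pmfMean_mono _ fun a => (le_optQ hc π n hn s a).trans
      (le_ciSup (Set.finite_range fun a => optQ L k (history e k) (n + 1) s a).bddAbove a)

/-- Pessimism: the pessimistic evaluation of a policy is below its value. -/
lemma pessValue_le_value {M : MDP S A} {L : ℝ} {k : ℕ} {past : Fin k → Record S A M.horizon}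
    (hc : Concentrated M L past) (π : Policy S A) {n : ℕ} (hn : n ≤ M.horizon) (s : S) :
    pessValue L past π n s ≤ M.value π (M.horizon - n) s := by
  induction n generalizing s with
  | zero => simp [pessValue, M.value_of_horizon_le π le_rfl]
  | succ n ih =>
    refine max_le (M.value_nonneg π _ s) ?_
    rw [M.value_bellman π (by omega) s, show M.horizon - (n + 1) + 1 = M.horizon - n by omega]
    refine pmfMean_mono _ fun a => ?_
    have h1 := hc.abs_trans_sub_le s a (f := M.value π (M.horizon - n)) (B := M.horizon)
      fun x => by
        rw [abs_of_nonneg (M.value_nonneg π _ x)]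
        exact M.value_le_horizon π _ x
    have h2 : ∑ s', empTrans past s a s' * pessValue L past π n s' ≤
        ∑ s', empTrans past s a s' * M.value π (M.horizon - n) s' :=
      Finset.sum_le_sum fun s' _ =>
        mul_le_mul_of_nonneg_left (ih (by omega) s') (empTrans_nonneg past s a s')
    have h3 := hc.reward s a
    rw [abs_le] at h1 h3
    rw [bonus_eq]
    linarith [h1.2, h3.2]

lemma pessValue_nonneg {k : ℕ} (L : ℝ) (past : Fin k → Record S A H) (π : Policy S A) (n : ℕ)
    (s : S) : 0 ≤ pessValue L past π n s := by
  cases n with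
  | zero => exact le_rfl
  | succ n => exact le_max_left _ _

lemma optBackup_le_horizon {k : ℕ} (L : ℝ) (prev : ℕ → S → A → ℝ) (past : Fin k → Record S A H)
    (n : ℕ) (s : S) (a : A) : optBackup L prev past n s a ≤ H := by
  cases n with
  | zero => simp [optBackup]
  | succ n => exact (min_le_right _ _).trans (min_le_left _ _)

lemma optValueEstimate_le_horizon {k : ℕ} (L : ℝ) (past : Fin k → Record S A H) (n : ℕ) (s : S) :
    optValueEstimate L past n s ≤ H :=
  ciSup_le fun a => by cases k <;> exact optBackup_le_horizon L _ past n s a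

lemma optQ_succ_le {k : ℕ} (L : ℝ) (past : Fin k → Record S A H) (n : ℕ) (s : S) (a : A) :
    optQ L k past (n + 1) s a ≤ empReward past s a + bonus L past s a +
      ∑ s', empTrans past s a s' * optValueEstimate L past n s' := by
  cases k <;> exact (min_le_right _ _).trans (min_le_right _ _)

/-- The gap between the optimistic value function and the pessimistic evaluation of the greedy
policy, with `n` steps to go. -/
noncomputable def confidenceGap (L : ℝ) (sel : (A → ℝ) → A) {k : ℕ} (past : Fin k → Record S A H)
    (n : ℕ) (s : S) : ℝ :=
  optValueEstimate L past n s - pessValue L past (ucbviPolicy L sel past) n s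

lemma confidenceGap_zero (L : ℝ) (sel : (A → ℝ) → A) {k : ℕ} (past : Fin k → Record S A H)
    (s : S) : confidenceGap L sel past 0 s = 0 := by
  simp [confidenceGap, optValueEstimate_zero, pessValue]

lemma confidenceGap_le_horizon (L : ℝ) (sel : (A → ℝ) → A) {k : ℕ} (past : Fin k → Record S A H)
    (n : ℕ) (s : S) : confidenceGap L sel past n s ≤ H := by
  have h1 := optValueEstimate_le_horizon L past n s
  have h2 := pessValue_nonneg L past (ucbviPolicy L sel past) n s
  unfold confidenceGap
  linarith

/-- The greedy action attains the optimistic value, and both evaluations of it use the same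
empirical reward and transitions. Subtracting cancels the reward, adds the two bonuses and
propagates the gap; the truncations at `H` and `0` and the previous `Q` only shrink it. -/
lemma confidenceGap_succ_le (L : ℝ) {sel : (A → ℝ) → A}
    (hmax : ∀ (f : A → ℝ) (a : A), f a ≤ f (sel f)) {k : ℕ} (past : Fin k → Record S A H)
    {n : ℕ} (hn : n < H) (s : S) :
    confidenceGap L sel past (n + 1) s ≤
      2 * bonus L past s (ucbviAction L sel past (H - (n + 1)) s) +
        ∑ s', empTrans past s (ucbviAction L sel past (H - (n + 1)) s) s' *
          confidenceGap L sel past n s' := by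
  set a := ucbviAction L sel past (H - (n + 1)) s with ha
  have hsel : a = sel (optQ L k past (n + 1) s) := by
    rw [ha, ucbviAction, show H - (H - (n + 1)) = n + 1 by omega]
  have h1 : optValueEstimate L past (n + 1) s ≤ optQ L k past (n + 1) s a := by
    rw [hsel]
    exact ciSup_le fun a' => hmax _ a'
  have h2 : empReward past s a - bonus L past s a +
      ∑ s', empTrans past s a s' * pessValue L past (ucbviPolicy L sel past) n s' ≤
        pessValue L past (ucbviPolicy L sel past) (n + 1) s := by
    refine le_trans (le_of_eq ?_) (le_max_right _ _)
    exact (pmfMean_pure a fun a => empReward past s a - bonus L past s a +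
      ∑ s', empTrans past s a s' * pessValue L past (ucbviPolicy L sel past) n s').symm
  have h3 := optQ_succ_le L past n s a
  have h4 : ∑ s', empTrans past s a s' * confidenceGap L sel past n s' =
      ∑ s', empTrans past s a s' * optValueEstimate L past n s' -
        ∑ s', empTrans past s a s' * pessValue L past (ucbviPolicy L sel past) n s' := by
    rw [← Finset.sum_sub_distrib]
    exact Finset.sum_congr rfl fun s' _ => mul_sub _ _ _
  rw [h4]
  unfold confidenceGap
  linarith

lemma confidenceGap_nonneg {M : MDP S A} {L : ℝ} {e : ℕ → Record S A M.horizon} {k : ℕ}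
    (hc : ∀ j ≤ k, Concentrated M L (history e j)) (sel : (A → ℝ) → A) {n : ℕ}
    (hn : n ≤ M.horizon) (s : S) : 0 ≤ confidenceGap L sel (history e k) n s :=
  sub_nonneg.2 ((pessValue_le_value (hc k le_rfl) _ hn s).trans
    (value_le_optValueEstimate hc _ hn s))

/-- The pathwise deviation of the gap at the observed transition `tr` of step `h`. -/
noncomputable def gapNoise (M : MDP S A) (L : ℝ) (sel : (A → ℝ) → A) {k : ℕ}
    (past : Fin k → Record S A M.horizon) (h : ℕ) (tr : Transition S A) : ℝ :=
  pmfMean (M.trans tr.1 tr.2.1)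
      (fun y => max 0 (confidenceGap L sel past (M.horizon - (h + 1)) y)) -
    max 0 (confidenceGap L sel past (M.horizon - (h + 1)) tr.2.2.2)

/-- The width of the confidence interval paid per visit; `C` bounds the gap before the last step. -/
noncomputable def visitCost (S : Type*) [Fintype S] (L C : ℝ) (H N : ℕ) : ℝ :=
  (2 * H + C) * transRadius S L N + 2 * rewardRadius L N

/-- Two replacements in the empirical recursion: empirical by true transitions, at cost `C` times
the `ℓ¹` radius, and the true expectation by the observed next state, at cost `gapNoise`. -/
lemma confidenceGap_succ_le_visitCost {M : MDP S A} {L : ℝ} {e : ℕ → Record S A M.horizon} {k : ℕ}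
    (hc : ∀ j ≤ k, Concentrated M L (history e j)) {sel : (A → ℝ) → A}
    (hmax : ∀ (f : A → ℝ) (a : A), f a ≤ f (sel f)) {C : ℝ}
    (hC : ∀ n < M.horizon, ∀ s, confidenceGap L sel (history e k) n s ≤ C)
    {h : ℕ} (hh : h < M.horizon) (s s' : S) (r : ℝ) :
    let a := ucbviAction L sel (history e k) h s
    confidenceGap L sel (history e k) (M.horizon - h) s ≤
      visitCost S L C M.horizon (visits (history e k) s a) +
        gapNoise M L sel (history e k) h (s, a, r, s') +
        confidenceGap L sel (history e k) (M.horizon - (h + 1)) s' := by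
  intro a
  obtain ⟨n, hn⟩ : ∃ n, M.horizon = n + 1 + h := ⟨M.horizon - h - 1, by omega⟩
  have e1 : M.horizon - h = n + 1 := by omega
  have e2 : M.horizon - (h + 1) = n := by omega
  have e3 : M.horizon - (n + 1) = h := by omega
  have hg := fun y => confidenceGap_nonneg hc sel (n := n) (by omega) y
  have h1 := confidenceGap_succ_le L hmax (history e k) (n := n) (by omega) s
  have h2 := (hc k le_rfl).abs_trans_sub_le s a (f := confidenceGap L sel (history e k) n) (B := C)
    fun y => by
      rw [abs_of_nonneg (hg y)]
      exact hC n (by omega) y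
  rw [e3] at h1
  rw [e1, e2, gapNoise, e2]
  -- The truncation in `gapNoise` keeps its summands in `[0, H]` for every history, as Hoeffding's
  -- lemma requires. Under concentration the gap is nonnegative and the truncation is inactive.
  simp only [max_eq_right (hg _)]
  rw [abs_le] at h2
  rw [bonus_eq] at h1
  unfold visitCost
  have h3 := h2.2
  change _ ≤ 2 * (_ * transRadius S L (visits (history e k) s a) +
    rewardRadius L (visits (history e k) s a)) +
      ∑ s', empTrans (history e k) s a s' * _ at h1
  have h4 : pmfMean (M.trans s a) (fun y => confidenceGap L sel (history e k) n y) =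
    pmfMean (M.trans s a) (confidenceGap L sel (history e k) n) := rfl
  linarith

end Confidence

/-! ### Visit counts and the pigeonhole bound -/

section Runs

variable {S A : Type*} [Fintype S] [Fintype A] {H : ℕ}

lemma countFlag_zero (e : ℕ → Record S A H) (b : Bool) : countFlag (history e 0) b = 0 := by
  simp [countFlag]

lemma countFlag_eq_sum (e : ℕ → Record S A H) (k : ℕ) (b : Bool) :
    countFlag (history e k) b =
      ∑ l ∈ Finset.range k, if Record.explored (e l) = b then 1 else 0 := by
  rw [countFlag, Finset.card_filter,
    Finset.sum_range fun l => if Record.explored (e l) = b then 1 else 0]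

lemma countFlag_succ (e : ℕ → Record S A H) (k : ℕ) (b : Bool) :
    countFlag (history e (k + 1)) b =
      countFlag (history e k) b + if Record.explored (e k) = b then 1 else 0 := by
  simp only [countFlag_eq_sum, Finset.sum_range_succ]

lemma countFlag_mono (e : ℕ → Record S A H) (b : Bool) :
    Monotone fun k => countFlag (history e k) b :=
  monotone_nat_of_le_succ fun k => by rw [countFlag_succ]; omega

lemma countFlag_true_add_false (e : ℕ → Record S A H) (k : ℕ) :
    countFlag (history e k) true + countFlag (history e k) false = k := by
  induction k with
  | zero => simp [countFlag_zero]
  | succ k ih =>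
    rw [countFlag_succ, countFlag_succ]
    cases Record.explored (e k) <;> simp <;> omega

/-- The number of visits of `(s, a)` in one episode, if it was non-conservative. -/
noncomputable def episodeVisits (r : Record S A H) (s : S) (a : A) : ℕ :=
  ∑ h, if Record.explored r = true ∧ (r.2 h).1 = s ∧ (r.2 h).2.1 = a then 1 else 0

lemma visits_zero (e : ℕ → Record S A H) (s : S) (a : A) : visits (history e 0) s a = 0 := by
  simp [visits]

lemma visits_eq_sum (e : ℕ → Record S A H) (k : ℕ) (s : S) (a : A) :
    visits (history e k) s a = ∑ l ∈ Finset.range k, episodeVisits (e l) s a := by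
  rw [Finset.sum_range fun l => episodeVisits (e l) s a]
  rfl

lemma visits_succ (e : ℕ → Record S A H) (k : ℕ) (s : S) (a : A) :
    visits (history e (k + 1)) s a = visits (history e k) s a + episodeVisits (e k) s a := by
  simp only [visits_eq_sum, Finset.sum_range_succ]

lemma episodeVisits_le (r : Record S A H) (s : S) (a : A) : episodeVisits r s a ≤ H := by
  unfold episodeVisits
  refine (Finset.sum_le_card_nsmul _ _ 1 fun h _ => ?_).trans (by simp)
  split_ifs <;> simp

lemma sum_sum_ite_mul (r : Record S A H) (g : S → A → ℝ) :
    ∑ s, ∑ a, (episodeVisits r s a : ℝ) * g s a =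
      if Record.explored r = true then ∑ h, g (r.2 h).1 (r.2 h).2.1 else 0 := by
  by_cases hr : Record.explored r = true
  · simp only [episodeVisits, hr, true_and, if_true, Nat.cast_sum, Finset.sum_mul]
    have : ∀ s, ∑ a, ∑ h, (((if (r.2 h).1 = s ∧ (r.2 h).2.1 = a then 1 else 0 : ℕ) : ℝ) * g s a) =
        ∑ h, ∑ a, (((if (r.2 h).1 = s ∧ (r.2 h).2.1 = a then 1 else 0 : ℕ) : ℝ) * g s a) :=
      fun s => Finset.sum_comm
    simp only [this]
    rw [Finset.sum_comm]
    refine Finset.sum_congr rfl fun h _ => ?_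
    rw [Finset.sum_eq_single (r.2 h).1, Finset.sum_eq_single (r.2 h).2.1]
    · simp
    · intro a _ ha
      simp [ha.symm]
    · simp
    · intro s _ hs
      simp [hs.symm]
    · simp
  · simp [episodeVisits, hr]

lemma sum_visits (e : ℕ → Record S A H) (k : ℕ) :
    ∑ s, ∑ a, (visits (history e k) s a : ℝ) = countFlag (history e k) true * H := by
  induction k with
  | zero => simp [visits_zero, countFlag_zero]
  | succ k ih =>
    simp only [visits_succ, Nat.cast_add, Finset.sum_add_distrib, ih, countFlag_succ]
    have := sum_sum_ite_mul (e k) fun _ _ => 1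
    simp only [mul_one] at this
    rw [this]
    split_ifs <;> simp [add_mul]

/-- The constant of the pigeonhole bound. -/
noncomputable def pigeonholeConst (H : ℕ) : ℝ := 1 + Real.sqrt (1 + H)

/-- Counts are updated only between episodes, so one episode may add up to `H` visits at the old
width. Factoring `n` as a difference of squares and using `N + n ≤ (1 + H) max 1 N` turns this delay
into the constant `1 + √(1 + H)`. -/
lemma div_sqrt_le_sqrt_sub_sqrt {n N : ℕ} (hn : n ≤ H) :
    (n : ℝ) * (1 / Real.sqrt (max 1 (N : ℝ))) ≤
      pigeonholeConst H * (Real.sqrt ((N + n : ℕ) : ℝ) - Real.sqrt (N : ℝ)) := by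
  have hnH : (n : ℝ) ≤ H := by exact_mod_cast hn
  have hm : (0 : ℝ) < max 1 (N : ℝ) := lt_of_lt_of_le one_pos (le_max_left _ _)
  have hs := Real.sqrt_pos.2 hm
  have hd : 0 ≤ Real.sqrt ((N + n : ℕ) : ℝ) - Real.sqrt (N : ℝ) :=
    sub_nonneg.2 (Real.sqrt_le_sqrt (by push_cast; linarith [Nat.cast_nonneg (α := ℝ) n]))
  have hsum : Real.sqrt ((N + n : ℕ) : ℝ) + Real.sqrt (N : ℝ) ≤
      pigeonholeConst H * Real.sqrt (max 1 (N : ℝ)) := by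
    have h1 : Real.sqrt ((N + n : ℕ) : ℝ) ≤ Real.sqrt (1 + H) * Real.sqrt (max 1 (N : ℝ)) := by
      rw [← Real.sqrt_mul (by positivity)]
      refine Real.sqrt_le_sqrt ?_
      push_cast
      have h2 := le_max_left 1 (N : ℝ)
      have h3 := le_max_right 1 (N : ℝ)
      have : (H : ℝ) * 1 ≤ H * max 1 (N : ℝ) := by gcongr
      linarith
    have h2 : Real.sqrt (N : ℝ) ≤ Real.sqrt (max 1 (N : ℝ)) := Real.sqrt_le_sqrt (le_max_right _ _)
    unfold pigeonholeConst
    linarith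
  have hsq : (n : ℝ) = (Real.sqrt ((N + n : ℕ) : ℝ) + Real.sqrt (N : ℝ)) *
      (Real.sqrt ((N + n : ℕ) : ℝ) - Real.sqrt (N : ℝ)) := by
    rw [← sq_sub_sq, Real.sq_sqrt (by positivity), Real.sq_sqrt (by positivity)]
    push_cast
    ring
  rw [mul_one_div, div_le_iff₀ hs]
  calc (n : ℝ) = _ := hsq
    _ ≤ pigeonholeConst H * Real.sqrt (max 1 (N : ℝ)) *
        (Real.sqrt ((N + n : ℕ) : ℝ) - Real.sqrt (N : ℝ)) := mul_le_mul_of_nonneg_right hsum hd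
    _ = _ := by ring

/-- For each pair the increments of `√N` telescope over episodes; Cauchy-Schwarz over the pairs then
uses that all visits together number `H` times the non-conservative episodes. -/
lemma sum_inv_sqrt_visits_le (e : ℕ → Record S A H) (k : ℕ) :
    ∑ l ∈ Finset.range k, (if Record.explored (e l) = true then
      ∑ h, 1 / Real.sqrt (max 1 (visits (history e l) ((e l).2 h).1 ((e l).2 h).2.1 : ℝ)) else 0) ≤
    pigeonholeConst H * Real.sqrt (Fintype.card S * Fintype.card A *
      (countFlag (history e k) true * H)) := by
  have hκ : 0 ≤ pigeonholeConst H := by unfold pigeonholeConst; positivity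
  have h1 : ∀ l, (if Record.explored (e l) = true then
      ∑ h, 1 / Real.sqrt (max 1 (visits (history e l) ((e l).2 h).1 ((e l).2 h).2.1 : ℝ)) else 0) ≤
      ∑ s, ∑ a, pigeonholeConst H * (Real.sqrt (visits (history e (l + 1)) s a : ℝ) -
        Real.sqrt (visits (history e l) s a : ℝ)) := by
    intro l
    rw [← sum_sum_ite_mul (e l) fun s a => 1 / Real.sqrt (max 1 (visits (history e l) s a : ℝ))]
    refine Finset.sum_le_sum fun s _ => Finset.sum_le_sum fun a _ => ?_
    rw [visits_succ]
    exact div_sqrt_le_sqrt_sub_sqrt (episodeVisits_le _ _ _)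
  have h2 : ∑ l ∈ Finset.range k, ∑ s, ∑ a, pigeonholeConst H *
      (Real.sqrt (visits (history e (l + 1)) s a : ℝ) -
        Real.sqrt (visits (history e l) s a : ℝ)) =
      pigeonholeConst H * ∑ p : S × A, Real.sqrt (visits (history e k) p.1 p.2 : ℝ) := by
    rw [Finset.sum_comm, Fintype.sum_prod_type, Finset.mul_sum]
    refine Finset.sum_congr rfl fun s _ => ?_
    rw [Finset.sum_comm, Finset.mul_sum]
    refine Finset.sum_congr rfl fun a _ => ?_
    rw [← Finset.mul_sum, Finset.sum_range_sub fun l => Real.sqrt (visits (history e l) s a : ℝ),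
      visits_zero]
    simp
  refine (Finset.sum_le_sum fun l _ => h1 l).trans ?_
  rw [h2]
  refine mul_le_mul_of_nonneg_left ?_ hκ
  refine Real.le_sqrt_of_sq_le ?_
  refine sq_sum_le_card_mul_sum_sq.trans ?_
  simp only [Real.sq_sqrt (Nat.cast_nonneg _)]
  rw [Fintype.sum_prod_type, sum_visits]
  simp

lemma visitCost_eq (L C : ℝ) (N : ℕ) :
    visitCost S L C H N = Real.sqrt L *
      ((2 * H + C) * Real.sqrt (2 * Fintype.card S) + 4) * (1 / Real.sqrt (max 1 (N : ℝ))) := by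
  unfold visitCost transRadius rewardRadius
  rw [Real.sqrt_div' _ (by positivity), Real.sqrt_div' _ (by positivity),
    Real.sqrt_mul (by positivity)]
  ring

/-- An episode of a run in which the greedy policy of UCB-VI was executed. -/
def IsGreedyEpisode (L : ℝ) (sel : (A → ℝ) → A) (e : ℕ → Record S A H) (k : ℕ) : Prop :=
  ∃ (X : ℕ → S) (r : ℕ → ℝ), X 0 = Record.start (e k) ∧
    ∀ h : Fin H, (e k).2 h = (X h, ucbviAction L sel (history e k) h (X h), r h, X (h + 1))

variable [Nonempty A]

/-- The one-step bound is iterated along the trajectory; nothing remains at the end because the gap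
with no steps to go is zero. -/
lemma IsGreedyEpisode.confidenceGap_le {M : MDP S A} {L : ℝ} {e : ℕ → Record S A M.horizon}
    {k : ℕ} {sel : (A → ℝ) → A} (hg : IsGreedyEpisode L sel e k)
    (hc : ∀ j ≤ k, Concentrated M L (history e j))
    (hmax : ∀ (f : A → ℝ) (a : A), f a ≤ f (sel f)) {C : ℝ}
    (hC : ∀ n < M.horizon, ∀ s, confidenceGap L sel (history e k) n s ≤ C) :
    confidenceGap L sel (history e k) M.horizon (Record.start (e k)) ≤
      ∑ h, (visitCost S L C M.horizon (visits (history e k) ((e k).2 h).1 ((e k).2 h).2.1) +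
        gapNoise M L sel (history e k) h ((e k).2 h)) := by
  obtain ⟨X, r, h0, hX⟩ := hg
  have key : ∀ m ≤ M.horizon, confidenceGap L sel (history e k) M.horizon (X 0) ≤
      ∑ h ∈ Finset.range m, (visitCost S L C M.horizon
          (visits (history e k) (X h) (ucbviAction L sel (history e k) h (X h))) +
        gapNoise M L sel (history e k) h
          (X h, ucbviAction L sel (history e k) h (X h), r h, X (h + 1))) +
      confidenceGap L sel (history e k) (M.horizon - m) (X m) := by
    intro m
    induction m with
    | zero => simp
    | succ m ih =>
      intro hm
      have h1 := ih (by omega)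
      have h2 := confidenceGap_succ_le_visitCost hc hmax hC (h := m) (by omega) (X m) (X (m + 1))
        (r m)
      rw [Finset.sum_range_succ]
      simp only at h2
      linarith
  have h1 := key M.horizon le_rfl
  rw [Nat.sub_self, confidenceGap_zero, add_zero, Finset.sum_range, h0] at h1
  simpa only [hX] using h1

/-- The total gap of the greedy episodes, up to the martingale term. -/
lemma sum_confidenceGap_le {M : MDP S A} {L : ℝ} {e : ℕ → Record S A M.horizon}
    {k : ℕ} {sel : (A → ℝ) → A}
    (hg : ∀ l < k, Record.explored (e l) = true → IsGreedyEpisode L sel e l)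
    (hc : ∀ j < k, Concentrated M L (history e j))
    (hmax : ∀ (f : A → ℝ) (a : A), f a ≤ f (sel f)) {C : ℝ} (hC0 : 0 ≤ C)
    (hC : ∀ l < k, ∀ n < M.horizon, ∀ s, confidenceGap L sel (history e l) n s ≤ C) :
    ∑ l ∈ Finset.range k, (if Record.explored (e l) = true then
      confidenceGap L sel (history e l) M.horizon (Record.start (e l)) else 0) ≤
    Real.sqrt L * ((2 * M.horizon + C) * Real.sqrt (2 * Fintype.card S) + 4) *
      (pigeonholeConst M.horizon * Real.sqrt (Fintype.card S * Fintype.card A *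
        (countFlag (history e k) true * M.horizon))) +
    ∑ l ∈ Finset.range k, (if Record.explored (e l) = true then
      ∑ h : Fin M.horizon, gapNoise M L sel (history e l) h ((e l).2 h) else 0) := by
  have h1 := mul_le_mul_of_nonneg_left (sum_inv_sqrt_visits_le e k)
    (show 0 ≤ Real.sqrt L * ((2 * M.horizon + C) * Real.sqrt (2 * Fintype.card S) + 4) by
      positivity)
  refine le_trans ?_ (add_le_add_left h1 _)
  rw [Finset.mul_sum, ← Finset.sum_add_distrib]
  refine Finset.sum_le_sum fun l hl => ?_
  rw [Finset.mem_range] at hl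
  split_ifs with he
  · refine ((hg l hl he).confidenceGap_le (fun j hj => hc j (hj.trans_lt hl)) hmax
      (hC l hl)).trans (le_of_eq ?_)
    rw [Finset.sum_add_distrib, Finset.mul_sum]
    simp only [visitCost_eq L C]
  · simp

end Runs

/-! ### Pathwise coupling with UCB-VI -/

section Coupling

variable {S A : Type*} [Fintype S] [Fintype A] {H : ℕ}

lemma episode_eq (L : ℝ) (sel : (A → ℝ) → A) (rule : (k : ℕ) → (Fin k → Record S A H) → S → Prop)
    (start : (k : ℕ) → (Fin k → Record S A H) → S) (ω : Noise S A) (k : ℕ) :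
    let past := history (episode H L sel rule start ω) k
    let s := start k past
    let b : Bool := decide (rule k past s)
    episode H L sel rule start ω k = ((s, b), trajectory H
      (fun h ν x => if b = true then ucbviAction L sel past h x else ν.1 x)
      (fun h => ω (b, countFlag past b, h)) s) := by
  intro past s b
  rw [episode]

lemma start_episode (L : ℝ) (sel : (A → ℝ) → A)
    (rule : (k : ℕ) → (Fin k → Record S A H) → S → Prop)
    (start : (k : ℕ) → (Fin k → Record S A H) → S) (ω : Noise S A) (k : ℕ) :
    Record.start (episode H L sel rule start ω k) =
      start k (history (episode H L sel rule start ω) k) := by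
  rw [episode_eq, Record.start]

lemma explored_episode (L : ℝ) (sel : (A → ℝ) → A)
    (rule : (k : ℕ) → (Fin k → Record S A H) → S → Prop)
    (start : (k : ℕ) → (Fin k → Record S A H) → S) (ω : Noise S A) (k : ℕ) :
    Record.explored (episode H L sel rule start ω k) = true ↔
      rule k (history (episode H L sel rule start ω) k)
        (Record.start (episode H L sel rule start ω k)) := by
  rw [start_episode, episode_eq, Record.explored]
  simp

/-- The trajectory of the greedy policy on given noise. -/
noncomputable def greedyTrajectory (L : ℝ) (sel : (A → ℝ) → A) {k : ℕ}
    (past : Fin k → Record S A H) (s : S) (ν : ℕ → StepNoise S A) : Fin H → Transition S A :=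
  trajectory H (fun h _ x => ucbviAction L sel past h x) ν s

lemma episode_eq_of_explored {L : ℝ} {sel : (A → ℝ) → A}
    {rule : (k : ℕ) → (Fin k → Record S A H) → S → Prop}
    {start : (k : ℕ) → (Fin k → Record S A H) → S} {ω : Noise S A} {k : ℕ}
    (hk : Record.explored (episode H L sel rule start ω k) = true) :
    let past := history (episode H L sel rule start ω) k
    episode H L sel rule start ω k = ((start k past, true),
      greedyTrajectory L sel past (start k past) fun h => ω (true, countFlag past true, h)) := by
  intro past
  have h1 : decide (rule k past (start k past)) = true := by
    rw [episode_eq] at hk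
    exact hk
  rw [episode_eq]
  simp only [past] at h1
  simp only [h1, if_true]
  rfl

lemma isGreedyEpisode_of_explored {L : ℝ} {sel : (A → ℝ) → A}
    {rule : (k : ℕ) → (Fin k → Record S A H) → S → Prop}
    {start : (k : ℕ) → (Fin k → Record S A H) → S} {ω : Noise S A} {k : ℕ}
    (hk : Record.explored (episode H L sel rule start ω k) = true) :
    IsGreedyEpisode L sel (episode H L sel rule start ω) k := by
  set past := history (episode H L sel rule start ω) k with hpast
  let ν : ℕ → StepNoise S A := fun h => ω (true, countFlag past true, h)
  let X := rollout (fun h _ x => ucbviAction L sel past h x) ν (start k past)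
  refine ⟨X, fun h => ((ν h).2 (X h) (ucbviAction L sel past h (X h))).1, ?_, fun h => ?_⟩
  · rw [start_episode]
    rfl
  · conv_lhs => rw [episode_eq_of_explored hk]
    rfl

/-- Two histories with the same visit counts, transition counts and reward sums. -/
structure SameData {k k' : ℕ} (past : Fin k → Record S A H) (past' : Fin k' → Record S A H) :
    Prop where
  visits : visits past = visits past'
  transitionCount : transitionCount past = transitionCount past'
  rewardSum : rewardSum past = rewardSum past'

lemma SameData.optBackup_eq {k k' : ℕ} {past : Fin k → Record S A H}
    {past' : Fin k' → Record S A H} (h : SameData past past') (L : ℝ) (prev : ℕ → S → A → ℝ) :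
    optBackup L prev past = optBackup L prev past' := by
  funext n
  induction n with
  | zero => rfl
  | succ n ih =>
    funext s a
    simp only [optBackup, ih, empReward, empTrans, bonus, h.visits, h.transitionCount, h.rewardSum]

/-- The first backup is already below `H` and below its own empirical backup, so the second minimum
changes nothing. This is why a conservative episode does not move the `Q`-function, although its
index advances. -/
lemma optBackup_idem [Nonempty A] {k : ℕ} (L : ℝ) (prev : ℕ → S → A → ℝ)
    (past : Fin k → Record S A H) :
    optBackup L (optBackup L prev past) past = optBackup L prev past := by
  funext n
  induction n with
  | zero => rfl
  | succ n ih =>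
    funext s a
    rw [optBackup, ih]
    refine min_eq_left ?_
    rw [optBackup]
    exact min_le_right _ _

lemma SameData.optBackup_optQ [Nonempty A] {k k' : ℕ} {past : Fin k → Record S A H}
    {past' : Fin k' → Record S A H} (h : SameData past past') (L : ℝ) :
    optBackup L (optQ L k' past') past = optQ L k' past' := by
  rw [h.optBackup_eq]
  cases k' <;> exact optBackup_idem _ _ _

lemma transitionCount_succ (e : ℕ → Record S A H) (k : ℕ) (s : S) (a : A) (s' : S) :
    transitionCount (history e (k + 1)) s a s' = transitionCount (history e k) s a s' +
      ∑ h, if Record.explored (e k) = true ∧ ((e k).2 h).1 = s ∧ ((e k).2 h).2.1 = a ∧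
        ((e k).2 h).2.2.2 = s' then 1 else 0 := by
  simp only [transitionCount, Fin.sum_univ_castSucc]
  rfl

lemma rewardSum_succ (e : ℕ → Record S A H) (k : ℕ) (s : S) (a : A) :
    rewardSum (history e (k + 1)) s a = rewardSum (history e k) s a +
      ∑ h, if Record.explored (e k) = true ∧ ((e k).2 h).1 = s ∧ ((e k).2 h).2.1 = a then
        ((e k).2 h).2.2.1 else 0 := by
  simp only [rewardSum, Fin.sum_univ_castSucc]
  rfl

lemma SameData.succ_left {e : ℕ → Record S A H} {k k' : ℕ} {past' : Fin k' → Record S A H}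
    (h : SameData (history e k) past') (hk : Record.explored (e k) ≠ true) :
    SameData (history e (k + 1)) past' where
  visits := by
    funext s a
    rw [visits_succ, h.visits]
    simp [episodeVisits, hk]
  transitionCount := by
    funext s a s'
    rw [transitionCount_succ, h.transitionCount]
    simp [hk]
  rewardSum := by
    funext s a
    rw [rewardSum_succ, h.rewardSum]
    simp [hk]

lemma SameData.succ_succ {e e' : ℕ → Record S A H} {k k' : ℕ}
    (h : SameData (history e k) (history e' k')) (hk : e k = e' k') :
    SameData (history e (k + 1)) (history e' (k' + 1)) where
  visits := by
    funext s a
    rw [visits_succ, visits_succ, h.visits, hk]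
  transitionCount := by
    funext s a s'
    rw [transitionCount_succ, transitionCount_succ, h.transitionCount, hk]
  rewardSum := by
    funext s a
    rw [rewardSum_succ, rewardSum_succ, h.rewardSum, hk]

section

variable [Nonempty A] (L : ℝ) (sel : (A → ℝ) → A)
  (rule : (k : ℕ) → (Fin k → Record S A H) → S → Prop)
  (start : (k : ℕ) → (Fin k → Record S A H) → S) (x : ℕ → S) (ω : Noise S A)

lemma countFlag_always (j : ℕ) :
    countFlag (history (episode H L sel (fun _ _ _ => True) (fun k _ => x k) ω) j) true = j := by
  induction j with
  | zero => exact countFlag_zero _ _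
  | succ j ih => rw [countFlag_succ, ih, if_pos ((explored_episode ..).2 trivial)]

/-- The coupling: while the starting states agree, the `j`-th non-conservative episode of a run
coincides with the `j`-th episode of UCB-VI. -/
lemma coupling {K : ℕ}
    (hx : ∀ k < K, Record.explored (episode H L sel rule start ω k) = true →
      x (countFlag (history (episode H L sel rule start ω) k) true) =
        Record.start (episode H L sel rule start ω k)) :
    ∀ k ≤ K,
      let e := episode H L sel rule start ω
      let e' := episode H L sel (fun _ _ _ => True) (fun k _ => x k) ω
      let j := countFlag (history e k) true
      SameData (history e k) (history e' j) ∧ optQ L k (history e k) = optQ L j (history e' j) ∧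
      (k < K → Record.explored (e k) = true → e k = e' j) := by
  intro k
  set e := episode H L sel rule start ω with he
  set e' := episode H L sel (fun _ _ _ => True) (fun k _ => x k) ω with he'
  have key : ∀ k, optQ L k (history e k) = optQ L (countFlag (history e k) true)
      (history e' (countFlag (history e k) true)) → k < K → Record.explored (e k) = true →
      e k = e' (countFlag (history e k) true) := by
    intro k hQ hk hexp
    have hexp' : Record.explored (e' (countFlag (history e k) true)) = true :=
      (explored_episode ..).2 trivial
    have hs : start k (history e k) = x (countFlag (history e k) true) := by
      rw [hx k hk hexp, he, start_episode]
    have hact : ucbviAction L sel (history e k) =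
        ucbviAction L sel (history e' (countFlag (history e k) true)) := by
      funext h s
      rw [ucbviAction, ucbviAction, hQ]
    have h1 := episode_eq_of_explored hexp
    have h2 := episode_eq_of_explored hexp'
    simp only [← he, ← he'] at h1 h2
    -- UCB-VI explores in every episode, so its noise block has the episode's own index; both runs
    -- thus read block `(true, j, ·)`.
    rw [h1, h2, hs, greedyTrajectory, greedyTrajectory, hact, countFlag_always]
  induction k with
  | zero =>
    intro _
    simp only
    have hj : countFlag (history e 0) true = 0 := countFlag_zero _ _
    have h0 : SameData (history e 0) (history e' 0) := by
      constructor
      · funext s a; rw [visits_zero, visits_zero]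
      · funext s a s'; simp [transitionCount]
      · funext s a; simp [rewardSum]
    have hQ : optQ L 0 (history e 0) = optQ L (countFlag (history e 0) true)
        (history e' (countFlag (history e 0) true)) := by
      rw [hj]
      exact h0.optBackup_eq _ _
    refine ⟨by rw [hj]; exact h0, hQ, key 0 hQ⟩
  | succ k ih =>
    intro hk
    obtain ⟨hd, hQ, hrec⟩ := ih (by omega)
    simp only at hd hQ hrec ⊢
    suffices h : SameData (history e (k + 1)) (history e' (countFlag (history e (k + 1)) true)) ∧
        optQ L (k + 1) (history e (k + 1)) = optQ L (countFlag (history e (k + 1)) true)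
          (history e' (countFlag (history e (k + 1)) true)) from ⟨h.1, h.2, key (k + 1) h.2⟩
    have hQs : optQ L (k + 1) (history e (k + 1)) =
      optBackup L (optQ L k (history e k)) (history e (k + 1)) := rfl
    by_cases hexp : Record.explored (e k) = true
    · have hc : countFlag (history e (k + 1)) true = countFlag (history e k) true + 1 := by
        rw [countFlag_succ, if_pos hexp]
      have hd' := hd.succ_succ (hrec (by omega) hexp)
      rw [hc]
      refine ⟨hd', ?_⟩
      rw [hQs, hQ, hd'.optBackup_eq]
      rfl
    · have hc : countFlag (history e (k + 1)) true = countFlag (history e k) true := by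
        rw [countFlag_succ, if_neg hexp, add_zero]
      have hd' := hd.succ_left hexp
      rw [hc]
      -- After a conservative episode the backup is repeated on unchanged data, hence has no effect.
      exact ⟨hd', by rw [hQs, hQ, hd'.optBackup_optQ]⟩

/-- Reindexes episodes by the number of non-conservative ones before them, which enumerates the
latter as `0, 1, …` without gaps. -/
lemma sum_explored_countFlag (e : ℕ → Record S A H) (t : ℕ → ℝ) (K : ℕ) :
    ∑ k ∈ Finset.range K,
      (if Record.explored (e k) = true then t (countFlag (history e k) true) else 0) =
    ∑ j ∈ Finset.range (countFlag (history e K) true), t j := by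
  induction K with
  | zero => simp [countFlag_zero]
  | succ K ih =>
    rw [Finset.sum_range_succ, ih, countFlag_succ]
    split_ifs with h
    · rw [Finset.sum_range_succ]
    · simp

end

/-- The regret of a run exceeds the regret of the coupled run of UCB-VI at most by the loss of its
conservative episodes. -/
lemma regret_le_regret_ucbvi_add [Nonempty A] (M : MDP S A) (πb : Policy S A) (L : ℝ)
    (sel : (A → ℝ) → A)
    (rule : (k : ℕ) → (Fin k → Record S A M.horizon) → S → Prop)
    (start : (k : ℕ) → (Fin k → Record S A M.horizon) → S) (x : ℕ → S) (ω : Noise S A) {K : ℕ}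
    (hx : ∀ k < K, Record.explored (episode M.horizon L sel rule start ω k) = true →
      x (countFlag (history (episode M.horizon L sel rule start ω) k) true) =
        Record.start (episode M.horizon L sel rule start ω k)) :
    regret M πb L sel (episode M.horizon L sel rule start ω) K ≤
      regret M πb L sel (ucbvi M L sel (fun k _ => x k) ω) K +
        M.horizon * countFlag (history (episode M.horizon L sel rule start ω) K) false := by
  have hcoup := coupling L sel rule start x ω hx
  set e := episode M.horizon L sel rule start ω with he
  set e' := episode M.horizon L sel (fun _ _ _ => True) (fun k _ => x k) ω with he'
  set t : ℕ → ℝ := fun j => M.optValue 0 (Record.start (e' j)) -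
    M.value (executed πb L sel e' j) 0 (Record.start (e' j)) with ht
  have ht0 : ∀ j, 0 ≤ t j := fun j => sub_nonneg.2 (M.value_le_optValue _ _ _)
  have hterm : ∀ k ∈ Finset.range K, M.optValue 0 (Record.start (e k)) -
      M.value (executed πb L sel e k) 0 (Record.start (e k)) ≤
      (if Record.explored (e k) = true then t (countFlag (history e k) true) else 0) +
        M.horizon * ((if Record.explored (e k) = false then 1 else 0 : ℕ) : ℝ) := by
    intro k hk
    rw [Finset.mem_range] at hk
    by_cases hexp : Record.explored (e k) = true
    · obtain ⟨_, hQ, hrec⟩ := hcoup k hk.le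
      have hrec := hrec hk hexp
      have hpol : executed πb L sel e k = executed πb L sel e' (countFlag (history e k) true) := by
        rw [executed, executed, if_pos hexp, if_pos (by rw [← hrec]; exact hexp)]
        have : ucbviAction L sel (history e k) =
            ucbviAction L sel (history e' (countFlag (history e k) true)) := by
          funext h s
          rw [ucbviAction, ucbviAction]
          exact congrArg (fun Q => sel (Q (M.horizon - h) s)) hQ
        exact congrArg Policy.ofDet this
      rw [if_pos hexp, hpol, hrec]
      simp only [ht]
      refine le_add_of_nonneg_right (by positivity)
    · have hf : Record.explored (e k) = false := by simpa using hexp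
      rw [if_neg hexp, if_pos hf]
      have h1 : M.optValue 0 (Record.start (e k)) ≤ M.horizon :=
        M.optValue_le fun π => M.value_le_horizon π _ _
      have h2 := M.value_nonneg (executed πb L sel e k) 0 (Record.start (e k))
      push_cast
      linarith
  have hcount : countFlag (history e K) true ≤ K := by
    have := countFlag_true_add_false e K
    omega
  calc regret M πb L sel e K ≤ _ := Finset.sum_le_sum hterm
    _ = ∑ j ∈ Finset.range (countFlag (history e K) true), t j +
        M.horizon * countFlag (history e K) false := by
      rw [Finset.sum_add_distrib, sum_explored_countFlag, ← Finset.mul_sum,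
        countFlag_eq_sum e K false]
      push_cast
      rfl
    _ ≤ _ := by
      refine add_le_add_left ?_ _
      -- The UCB-VI run has `K` episodes, possibly more than were matched; the surplus ones have
      -- nonnegative regret whatever their starting states.
      exact Finset.sum_le_sum_of_subset_of_nonneg (Finset.range_mono hcount) fun j _ _ => ht0 j

end Coupling

/-! ### Resampling one coordinate, and Ville's inequality -/

section Resampling

lemma measurable_update_prod {ι : Type*} [DecidableEq ι] {X : ι → Type*}
    [∀ i, MeasurableSpace (X i)] (c : ι) :
    Measurable fun p : (∀ i, X i) × X c => Function.update p.1 c p.2 := by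
  refine measurable_pi_lambda _ fun i => ?_
  by_cases hi : i = c
  · subst hi
    simpa using measurable_snd
  · simp only [Function.update_of_ne hi]
    exact (measurable_pi_apply i).comp measurable_fst

/-- Resampling one coordinate preserves an infinite product measure. -/
lemma map_update_infinitePi {ι : Type*} [DecidableEq ι] {X : ι → Type*} [∀ i, MeasurableSpace (X i)]
    (μ : ∀ i, Measure (X i)) [∀ i, IsProbabilityMeasure (μ i)] (c : ι) :
    ((Measure.infinitePi μ).prod (μ c)).map (fun p => Function.update p.1 c p.2) =
      Measure.infinitePi μ := by
  have hmeas := measurable_update_prod (X := X) c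
  refine Measure.eq_infinitePi μ fun s t ht => ?_
  rw [Measure.map_apply hmeas (MeasurableSet.pi s.countable_toSet fun i _ => ht i)]
  -- The constraint on coordinate `c` moves from the old sequence to the fresh sample, so the
  -- preimage of a cylinder is a rectangle.
  have hpre : (fun p : (∀ i, X i) × X c => Function.update p.1 c p.2) ⁻¹' Set.pi s t =
      (Set.pi (s.erase c : Finset ι) t) ×ˢ (if c ∈ s then t c else Set.univ) := by
    ext p
    simp only [Set.mem_preimage, Set.mem_pi, Set.mem_prod, Finset.mem_coe, Finset.mem_erase]
    constructor
    · intro h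
      refine ⟨fun i hi => ?_, ?_⟩
      · simpa [Function.update_of_ne hi.1] using h i hi.2
      · split_ifs with hc
        · simpa using h c hc
        · trivial
    · rintro ⟨h1, h2⟩ i hi
      by_cases hic : i = c
      · subst hic
        simpa [hi] using h2
      · simpa [Function.update_of_ne hic] using h1 i ⟨hic, hi⟩
  rw [hpre, Measure.prod_prod, Measure.infinitePi_pi _ fun i _ => ht i]
  split_ifs with hc
  · rw [mul_comm, Finset.mul_prod_erase s (fun i => μ i (t i)) hc]
  · rw [measure_univ, mul_one, Finset.erase_eq_of_notMem hc]

/-- The inner integral plays the part of the conditional expectation given all coordinates except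
`c`. The factor `ζ`, which carries the randomness of the starting states, stays fixed. -/
lemma lintegral_prod_infinitePi_update {Z ι : Type*} [DecidableEq ι] [MeasurableSpace Z] {X : ι → Type*}
    [∀ i, MeasurableSpace (X i)] (ζ : Measure Z) [IsProbabilityMeasure ζ]
    (μ : ∀ i, Measure (X i)) [∀ i, IsProbabilityMeasure (μ i)] (c : ι)
    {φ : Z × (∀ i, X i) → ENNReal} (hφ : Measurable φ) :
    ∫⁻ p, φ p ∂(ζ.prod (Measure.infinitePi μ)) =
      ∫⁻ p, ∫⁻ x, φ (p.1, Function.update p.2 c x) ∂(μ c) ∂(ζ.prod (Measure.infinitePi μ)) := by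
  have hmeas := measurable_update_prod (X := X) c
  have hupd : Measurable fun q : (Z × (∀ i, X i)) × X c => (q.1.1, Function.update q.1.2 c q.2) :=
    (measurable_fst.comp measurable_fst).prodMk
      (hmeas.comp ((measurable_snd.comp measurable_fst).prodMk measurable_snd))
  have hinner : Measurable fun p : Z × (∀ i, X i) =>
      ∫⁻ x, φ (p.1, Function.update p.2 c x) ∂(μ c) := (hφ.comp hupd).lintegral_prod_right'
  rw [lintegral_prod _ hφ.aemeasurable, lintegral_prod _ hinner.aemeasurable]
  refine lintegral_congr fun z => ?_
  have hz : Measurable fun ω : ∀ i, X i => φ (z, ω) := hφ.comp measurable_prodMk_left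
  conv_lhs => rw [← map_update_infinitePi μ c]
  rw [lintegral_map hz hmeas]
  exact lintegral_prod _ (hz.comp hmeas).aemeasurable

variable {Ω X : Type*}

/-- The partial sums of `F`, stopped when they reach the level `u`. -/
noncomputable def stoppedSum (F : ℕ → Ω → ℝ) (u : ℝ) : ℕ → Ω → ℝ
  | 0 => fun _ => 0
  | t + 1 => fun ω => stoppedSum F u t ω + if u ≤ stoppedSum F u t ω then 0 else F t ω

lemma stoppedSum_succ (F : ℕ → Ω → ℝ) (u : ℝ) (t : ℕ) (ω : Ω) :
    stoppedSum F u (t + 1) ω =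
      stoppedSum F u t ω + if u ≤ stoppedSum F u t ω then 0 else F t ω := rfl

/-- Once the level is reached the stopped sum is frozen; until then it is the ordinary partial sum.
Its final value therefore detects a crossing at any earlier time. -/
lemma stoppedSum_dichotomy (F : ℕ → Ω → ℝ) (u : ℝ) (ω : Ω) (T : ℕ) :
    u ≤ stoppedSum F u T ω ∨
      ∀ t ≤ T, ∑ s ∈ Finset.range t, F s ω < u ∧
        stoppedSum F u t ω = ∑ s ∈ Finset.range t, F s ω := by
  induction T with
  | zero =>
    by_cases hu : u ≤ 0
    · exact Or.inl hu
    · refine Or.inr fun t ht => ?_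
      obtain rfl : t = 0 := by omega
      simpa [stoppedSum] using not_le.1 hu
  | succ T ih =>
    rcases ih with ih | ih
    · left
      rw [stoppedSum_succ]
      simp [ih]
    · by_cases hu : u ≤ stoppedSum F u (T + 1) ω
      · exact Or.inl hu
      · right
        intro t ht
        rcases Nat.lt_or_ge T t with h | h
        · obtain rfl : t = T + 1 := by omega
          have h1 := ih T le_rfl
          have h2 : stoppedSum F u (T + 1) ω = ∑ s ∈ Finset.range (T + 1), F s ω := by
            rw [stoppedSum_succ, if_neg (by rw [h1.2]; exact not_le.2 h1.1), h1.2,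
              Finset.sum_range_succ]
          exact ⟨by rw [← h2]; exact not_le.1 hu, h2⟩
        · exact ih t h

variable [MeasurableSpace Ω] [MeasurableSpace X]

/-- Ville's inequality for an exponential supermartingale given by resampling: `R t ω x` is `ω` with
the randomness of time `t` replaced by `x`. -/
lemma measure_exists_le_sum_le_exp (P : Measure Ω) [IsProbabilityMeasure P] (μ : ℕ → Measure X)
    (R : ℕ → Ω → X → Ω)
    (hR : ∀ t, ∀ φ : Ω → ENNReal, Measurable φ → ∫⁻ ω, φ ω ∂P = ∫⁻ ω, ∫⁻ x, φ (R t ω x) ∂(μ t) ∂P)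
    (F : ℕ → Ω → ℝ) (hF : ∀ t, Measurable (F t))
    (hadapt : ∀ s t, s < t → ∀ ω x, F s (R t ω x) = F s ω)
    (hint : ∀ t ω, ∫⁻ x, ENNReal.ofReal (Real.exp (F t (R t ω x))) ∂(μ t) ≤ 1)
    [∀ t, IsProbabilityMeasure (μ t)] (u : ℝ) (T : ℕ) :
    P {ω | ∃ t ≤ T, u ≤ ∑ s ∈ Finset.range t, F s ω} ≤ ENNReal.ofReal (Real.exp (-u)) := by
  have hY : ∀ t, Measurable (stoppedSum F u t) := by
    intro t
    induction t with
    | zero => exact measurable_const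
    | succ t ih =>
      exact ih.add (Measurable.ite (measurableSet_le measurable_const ih) measurable_const (hF t))
  have hYad : ∀ s t, s ≤ t → ∀ ω x, stoppedSum F u s (R t ω x) = stoppedSum F u s ω := by
    intro s
    induction s with
    | zero => intros; rfl
    | succ s ih =>
      intro t ht ω x
      rw [stoppedSum_succ, ih t (by omega), hadapt s t (by omega), stoppedSum_succ]
  -- Supermartingale property: after resampling time `t`, the sum so far is unchanged and the new
  -- factor has integral at most one.
  have hexp : ∀ t, ∫⁻ ω, ENNReal.ofReal (Real.exp (stoppedSum F u t ω)) ∂P ≤ 1 := by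
    intro t
    induction t with
    | zero => simp [stoppedSum]
    | succ t ih =>
      refine le_trans ?_ ih
      rw [hR t (fun ω => ENNReal.ofReal (Real.exp (stoppedSum F u (t + 1) ω)))
        (Real.measurable_exp.comp (hY (t + 1))).ennreal_ofReal]
      refine lintegral_mono fun ω => ?_
      simp only [stoppedSum_succ, hYad t t le_rfl ω]
      split_ifs with h
      · simp
      · simp only [Real.exp_add, ENNReal.ofReal_mul (Real.exp_nonneg _)]
        rw [lintegral_const_mul' _ _ ENNReal.ofReal_ne_top]
        exact (mul_le_mul_right (hint t ω) _).trans (by rw [mul_one])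
  have hsub : {ω | ∃ t ≤ T, u ≤ ∑ s ∈ Finset.range t, F s ω} ⊆
      {ω | ENNReal.ofReal (Real.exp u) ≤ ENNReal.ofReal (Real.exp (stoppedSum F u T ω))} := by
    rintro ω ⟨t, ht, hu⟩
    rcases stoppedSum_dichotomy F u ω T with h | h
    · exact ENNReal.ofReal_le_ofReal (Real.exp_le_exp.2 h)
    · exact absurd hu (not_le.2 (h t ht).1)
  refine (measure_mono hsub).trans ?_
  refine (meas_ge_le_lintegral_div ((Real.measurable_exp.comp (hY T)).ennreal_ofReal).aemeasurable
    (by simpa using Real.exp_pos u) ENNReal.ofReal_ne_top).trans ?_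
  rw [Real.exp_neg, ENNReal.ofReal_inv_of_pos (Real.exp_pos u), ← one_div]
  exact ENNReal.div_le_div_right (hexp T) _

end Resampling

/-! ### Which noise a run depends on -/

section Adaptedness

variable {S A : Type*} [Fintype S] [Fintype A] {H : ℕ}

lemma rollout_congr {act : ℕ → StepNoise S A → S → A} {ν ν' : ℕ → StepNoise S A} {s : S} {m : ℕ}
    (h : ∀ i < m, ν i = ν' i) : rollout act ν s m = rollout act ν' s m := by
  induction m with
  | zero => rfl
  | succ m ih =>
    rw [rollout, rollout, ih fun i hi => h i (by omega), h m (by omega)]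

variable {L : ℝ} {sel : (A → ℝ) → A} {rule : (k : ℕ) → (Fin k → Record S A H) → S → Prop}
  {start : (k : ℕ) → (Fin k → Record S A H) → S} {ω ω' : Noise S A}

/-- The past of an episode depends on the noise of the earlier non-conservative episodes and of the
conservative ones only. -/
lemma history_congr {j : ℕ} (hω : ∀ b i h, (b = true → i < j) → ω (b, i, h) = ω' (b, i, h)) :
    ∀ k, countFlag (history (episode H L sel rule start ω) k) true ≤ j →
      history (episode H L sel rule start ω) k = history (episode H L sel rule start ω') k := by
  intro k
  induction k with
  | zero => intro _; funext l; exact l.elim0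
  | succ k ih =>
    intro hk
    have hle : countFlag (history (episode H L sel rule start ω) k) true ≤ j :=
      (countFlag_mono _ true (Nat.le_succ k)).trans hk
    have hpast := ih hle
    have hlast : episode H L sel rule start ω k = episode H L sel rule start ω' k := by
      by_cases hexp : Record.explored (episode H L sel rule start ω k) = true
      -- A non-conservative episode raises the count, which still is at most `j`; hence the block
      -- that it reads has index below `j`.
      · rw [countFlag_succ, if_pos hexp] at hk
        have h1 := episode_eq L sel rule start ω k
        have h2 := episode_eq L sel rule start ω' k
        rw [← hpast] at h2
        rw [h1, h2]
        congr 2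
        funext h
        exact hω _ _ _ fun _ => by
          have hb : decide (rule k (history (episode H L sel rule start ω) k)
            (start k (history (episode H L sel rule start ω) k))) = true := by
            rw [episode_eq] at hexp
            exact hexp
          rw [hb]
          omega
      · have h1 := episode_eq L sel rule start ω k
        have h2 := episode_eq L sel rule start ω' k
        rw [← hpast] at h2
        rw [h1, h2]
        congr 2
        funext h
        refine hω _ _ _ fun hb => ?_
        rw [episode_eq] at hexp
        exact absurd hb hexp
    funext l
    rcases Nat.lt_succ_iff_lt_or_eq.1 l.2 with hl | hl
    · exact congrFun hpast ⟨l, hl⟩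
    · simp only [history, hl]
      exact hlast

lemma start_congr {k : ℕ} (h : history (episode H L sel rule start ω) k =
    history (episode H L sel rule start ω') k) :
    Record.start (episode H L sel rule start ω k) =
      Record.start (episode H L sel rule start ω' k) := by
  rw [start_episode, start_episode, h]

lemma explored_congr {k : ℕ} (h : history (episode H L sel rule start ω) k =
    history (episode H L sel rule start ω') k) :
    Record.explored (episode H L sel rule start ω k) = true ↔
      Record.explored (episode H L sel rule start ω' k) = true := by
  rw [explored_episode, explored_episode, start_congr h, h]

lemma step_eq_of_explored {k : ℕ}
    (hk : Record.explored (episode H L sel rule start ω k) = true) (h : Fin H) :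
    let past := history (episode H L sel rule start ω) k
    let x := rollout (fun h _ x => ucbviAction L sel past h x)
      (fun i => ω (true, countFlag past true, i)) (start k past) h
    (episode H L sel rule start ω k).2 h = (x, ucbviAction L sel past h x,
      (ω (true, countFlag past true, h)).2 x (ucbviAction L sel past h x)) := by
  intro past x
  rw [episode_eq_of_explored hk]
  rfl

variable (H L sel rule start) in
/-- Episode `k` exists, is non-conservative, and is the `j`-th such episode. -/
def IsExploration (ω : Noise S A) (j k : ℕ) : Prop :=
  Record.explored (episode H L sel rule start ω k) = true ∧
    countFlag (history (episode H L sel rule start ω) k) true = j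

lemma IsExploration.unique {j k k' : ℕ} (h : IsExploration H L sel rule start ω j k)
    (h' : IsExploration H L sel rule start ω j k') : k = k' := by
  have key : ∀ k k', IsExploration H L sel rule start ω j k →
      IsExploration H L sel rule start ω j k' → ¬ k < k' := by
    intro k k' h h' hlt
    have h1 := countFlag_mono (episode H L sel rule start ω) true (Nat.succ_le_of_lt hlt)
    simp only at h1
    rw [Nat.succ_eq_add_one, countFlag_succ, if_pos h.1, h.2, h'.2] at h1
    omega
  have h1 := key k k' h h'
  have h2 := key k' k h' h
  omega

lemma isExploration_congr {i j : ℕ} (hij : i ≤ j)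
    (hω : ∀ b i h, (b = true → i < j) → ω (b, i, h) = ω' (b, i, h)) (k : ℕ) :
    IsExploration H L sel rule start ω i k ↔ IsExploration H L sel rule start ω' i k := by
  have key : ∀ ω ω' : Noise S A, (∀ b i h, (b = true → i < j) → ω (b, i, h) = ω' (b, i, h)) →
      IsExploration H L sel rule start ω i k → IsExploration H L sel rule start ω' i k := by
    intro ω ω' hω h
    have hh := history_congr (L := L) (sel := sel) (rule := rule) (start := start) hω k
      (h.2.le.trans hij)
    exact ⟨(explored_congr hh).1 h.1, by rw [← hh]; exact h.2⟩
  exact ⟨key ω ω' hω, key ω' ω fun b i h hb => (hω b i h hb).symm⟩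

/-- The contribution of step `h` of the `j`-th non-conservative episode among the first `K`. -/
noncomputable def explorationTerm (H : ℕ) (L : ℝ) (sel : (A → ℝ) → A)
    (rule : (k : ℕ) → (Fin k → Record S A H) → S → Prop)
    (start : (k : ℕ) → (Fin k → Record S A H) → S)
    (f : (k : ℕ) → (Fin k → Record S A H) → Fin H → Transition S A → ℝ) (K j : ℕ) (h : Fin H)
    (ω : Noise S A) : ℝ :=
  ∑ k ∈ Finset.range K, if IsExploration H L sel rule start ω j k then
    f k (history (episode H L sel rule start ω) k) h ((episode H L sel rule start ω k).2 h) else 0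

variable {f : (k : ℕ) → (Fin k → Record S A H) → Fin H → Transition S A → ℝ} {K : ℕ}

/-- Adaptedness in the lexicographic order of (non-conservative episode, step). Time is counted in
non-conservative episodes because these index the noise blocks; the noise of the conservative
episodes is treated as known from the start. -/
lemma explorationTerm_update {i j : ℕ} {h : Fin H} {h' : ℕ} (hlt : i < j ∨ i = j ∧ h.1 < h')
    (x : StepNoise S A) :
    explorationTerm H L sel rule start f K i h (Function.update ω (true, j, h') x) =
      explorationTerm H L sel rule start f K i h ω := by
  have hij : i ≤ j := by omega
  have hω : ∀ b i h, (b = true → i < j) →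
      Function.update ω (true, j, h') x (b, i, h) = ω (b, i, h) := by
    intro b i h hb
    refine Function.update_of_ne (fun heq => ?_) _ _
    simp only [Prod.mk.injEq] at heq
    have := hb heq.1
    omega
  refine Finset.sum_congr rfl fun k _ => ?_
  refine ite_congr (propext (isExploration_congr hij hω k)) (fun hk => ?_) fun _ => rfl
  have hk' := (isExploration_congr (L := L) (sel := sel) (rule := rule) (start := start)
    hij hω k).2 hk
  have hh := history_congr (L := L) (sel := sel) (rule := rule) (start := start) hω k
    (hk'.2.le.trans hij)
  rw [step_eq_of_explored hk.1, step_eq_of_explored hk'.1, hh]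
  simp only [hk.2]
  have hν : ∀ m ≤ h.1, Function.update ω (true, j, h') x (true, i, m) = ω (true, i, m) := by
    intro m hm
    refine Function.update_of_ne (fun heq => ?_) _ _
    simp only [Prod.mk.injEq] at heq
    omega
  rw [rollout_congr fun m hm => hν m hm.le, hν h.1 le_rfl]

/-- Whether a `j`-th non-conservative episode occurs, its past, and its state and action at step `h`
are all decided before the noise of that step is read. Only the reward and next state are fresh, so
the resampled increment is integrated at a fixed pair. -/
lemma explorationTerm_update_self (j : ℕ) (h : Fin H) :
    (∀ x, explorationTerm H L sel rule start f K j h (Function.update ω (true, j, h.1) x) = 0) ∨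
    ∃ k, ∃ past : Fin k → Record S A H, ∃ (s : S) (a : A), ∀ x,
      explorationTerm H L sel rule start f K j h (Function.update ω (true, j, h.1) x) =
        f k past h (s, a, x.2 s a) := by
  have hω : ∀ x : StepNoise S A, ∀ b i h', (b = true → i < j) →
      Function.update ω (true, j, h.1) x (b, i, h') = ω (b, i, h') := by
    intro x b i h' hb
    refine Function.update_of_ne (fun heq => ?_) _ _
    simp only [Prod.mk.injEq] at heq
    have := hb heq.1
    omega
  by_cases hex : ∃ k < K, IsExploration H L sel rule start ω j k
  · right
    obtain ⟨k, hkK, hk⟩ := hex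
    let past := history (episode H L sel rule start ω) k
    let y := rollout (fun h _ x => ucbviAction L sel past h x) (fun i => ω (true, j, i))
      (start k past) h
    refine ⟨k, past, y, ucbviAction L sel past h y, fun x => ?_⟩
    have hk' := (isExploration_congr (L := L) (sel := sel) (rule := rule) (start := start)
      le_rfl (hω x) k).2 hk
    have hh := history_congr (L := L) (sel := sel) (rule := rule) (start := start) (hω x) k
      hk'.2.le
    rw [explorationTerm, Finset.sum_eq_single k, if_pos hk', step_eq_of_explored hk'.1, hh]
    · simp only [hk.2]
      have hν : ∀ m < h.1, Function.update ω (true, j, h.1) x (true, j, m) = ω (true, j, m) := by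
        intro m hm
        refine Function.update_of_ne (fun heq => ?_) _ _
        simp only [Prod.mk.injEq] at heq
        omega
      rw [rollout_congr hν, Function.update_self]
    · intro k' _ hne
      exact if_neg fun h' => hne (h'.unique hk')
    · intro hn
      exact absurd (Finset.mem_range.2 hkK) hn
  · left
    intro x
    refine Finset.sum_eq_zero fun k hk => if_neg fun h' => hex ⟨k, Finset.mem_range.1 hk, ?_⟩
    exact (isExploration_congr le_rfl (hω x) k).1 h'

/-- Passes from the order by non-conservative episodes, in which the supermartingale lives, to the
order of the run. -/
lemma sum_explorationTerm {k : ℕ} (hk : k ≤ K) :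
    ∑ j ∈ Finset.range (countFlag (history (episode H L sel rule start ω) k) true),
      ∑ h, explorationTerm H L sel rule start f K j h ω =
    ∑ l ∈ Finset.range k, if Record.explored (episode H L sel rule start ω l) = true then
      ∑ h, f l (history (episode H L sel rule start ω) l) h
        ((episode H L sel rule start ω l).2 h) else 0 := by
  set e := episode H L sel rule start ω with he
  have h1 : ∀ j, ∑ h, explorationTerm H L sel rule start f K j h ω =
      ∑ l ∈ Finset.range K, if IsExploration H L sel rule start ω j l then
        ∑ h, f l (history e l) h ((e l).2 h) else 0 := by
    intro j
    simp only [explorationTerm]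
    rw [Finset.sum_comm]
    refine Finset.sum_congr rfl fun l _ => ?_
    split_ifs <;> simp [he]
  simp only [h1]
  rw [Finset.sum_comm]
  rw [← Finset.sum_subset (Finset.range_mono hk)]
  · refine Finset.sum_congr rfl fun l hl => ?_
    rw [Finset.mem_range] at hl
    by_cases hexp : Record.explored (e l) = true
    · have hlt : countFlag (history e l) true < countFlag (history e k) true := by
        have := countFlag_mono e true (Nat.succ_le_of_lt hl)
        simp only at this
        rw [Nat.succ_eq_add_one, countFlag_succ, if_pos hexp] at this
        omega
      rw [if_pos hexp, Finset.sum_eq_single (countFlag (history e l) true)]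
      · exact if_pos ⟨hexp, rfl⟩
      · intro j _ hj
        exact if_neg fun h => hj h.2.symm
      · intro hn
        exact absurd (Finset.mem_range.2 hlt) hn
    · rw [if_neg hexp]
      exact Finset.sum_eq_zero fun j _ => if_neg fun h => hexp h.1
  · intro l _ hl
    rw [Finset.mem_range, not_lt] at hl
    refine Finset.sum_eq_zero fun j hj => if_neg fun h => ?_
    have := countFlag_mono e true hl
    simp only at this
    rw [Finset.mem_range, ← h.2, ← he] at hj
    omega

/-- The sum of `f` over the steps of the non-conservative episodes among the first `k`. -/
noncomputable def explorationSum (f : (k : ℕ) → (Fin k → Record S A H) → Fin H → Transition S A → ℝ)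
    (e : ℕ → Record S A H) (k : ℕ) : ℝ :=
  ∑ l ∈ Finset.range k, if Record.explored (e l) = true then
    ∑ h, f l (history e l) h ((e l).2 h) else 0

lemma explorationSum_zero (f : (k : ℕ) → (Fin k → Record S A H) → Fin H → Transition S A → ℝ)
    (e : ℕ → Record S A H) : explorationSum f e 0 = 0 := Finset.sum_range_zero _

lemma explorationSum_succ (f : (k : ℕ) → (Fin k → Record S A H) → Fin H → Transition S A → ℝ)
    (e : ℕ → Record S A H) (k : ℕ) : explorationSum f e (k + 1) = explorationSum f e k +
      if Record.explored (e k) = true then ∑ h, f k (history e k) h ((e k).2 h) else 0 :=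
  Finset.sum_range_succ _ _

end Adaptedness

/-- States, actions and noise-block indices are random but discrete, so expressions evaluated at
them reduce to the case of a fixed index. -/
lemma measurable_apply_discrete {α β γ : Type*} [MeasurableSpace α] [MeasurableSpace β]
    [MeasurableSpace γ] [Countable β] [MeasurableSingletonClass β] {f : β → α → γ}
    (hf : ∀ b, Measurable (f b)) {g : α → β} (hg : Measurable g) : Measurable fun a => f (g a) a :=
  (measurable_from_prod_countable_left (f := fun p : α × β => f p.2 p.1) hf).comp
    (measurable_id.prodMk hg)

/-! ### Measurability of the statistics, the policy and the safety test -/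

section Measurability

variable {S A Ω : Type*} [Fintype S] [MeasurableSpace S] [MeasurableSingletonClass S]
  [Fintype A] [MeasurableSpace A] [MeasurableSingletonClass A] [MeasurableSpace Ω] {H k : ℕ}

lemma measurable_explored : Measurable (Record.explored (S := S) (A := A) (H := H)) :=
  measurable_snd.comp measurable_fst

lemma measurable_start : Measurable (Record.start (S := S) (A := A) (H := H)) :=
  measurable_fst.comp measurable_fst

variable {P : Ω → Fin k → Record S A H} (hP : Measurable P)

include hP

lemma measurable_record (l : Fin k) : Measurable fun ω => P ω l := (measurable_pi_apply l).comp hP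

lemma measurable_step (l : Fin k) (h : Fin H) : Measurable fun ω => (P ω l).2 h :=
  (measurable_pi_apply h).comp (measurable_snd.comp (measurable_record hP l))

lemma measurable_countFlag {b : Ω → Bool} (hb : Measurable b) :
    Measurable fun ω => countFlag (P ω) (b ω) := by
  let g : (Fin k → Bool) × Bool → ℕ := fun q => (Finset.univ.filter fun l => q.1 l = q.2).card
  have hg : Measurable g := measurable_of_countable g
  exact hg.comp ((measurable_pi_lambda _ fun l =>
    measurable_explored.comp (measurable_record hP l)).prodMk hb)

lemma measurableSet_visit (s : S) (a : A) (l : Fin k) (h : Fin H) :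
    MeasurableSet {ω | Record.explored (P ω l) = true ∧ ((P ω l).2 h).1 = s ∧
      ((P ω l).2 h).2.1 = a} := by
  have h1 := measurable_explored.comp (measurable_record hP l)
  have h2 := measurable_step hP l h
  exact (h1 (measurableSet_singleton true)).inter
    (((measurable_fst.comp h2) (measurableSet_singleton s)).inter
      ((measurable_fst.comp (measurable_snd.comp h2)) (measurableSet_singleton a)))

lemma measurable_visits (s : S) (a : A) : Measurable fun ω => visits (P ω) s a :=
  Finset.measurable_sum _ fun l _ => Finset.measurable_sum _ fun h _ =>
    Measurable.ite (measurableSet_visit hP s a l h) measurable_const measurable_const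

lemma measurable_rewardSum (s : S) (a : A) : Measurable fun ω => rewardSum (P ω) s a :=
  Finset.measurable_sum _ fun l _ => Finset.measurable_sum _ fun h _ =>
    Measurable.ite (measurableSet_visit hP s a l h)
      (measurable_fst.comp (measurable_snd.comp (measurable_snd.comp (measurable_step hP l h))))
      measurable_const

lemma measurable_transitionCount (s : S) (a : A) (s' : S) :
    Measurable fun ω => transitionCount (P ω) s a s' := by
  refine Finset.measurable_sum _ fun l _ => Finset.measurable_sum _ fun h _ =>
    Measurable.ite ?_ measurable_const measurable_const
  have h1 := (measurableSet_visit hP s a l h).inter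
    ((measurable_snd.comp (measurable_snd.comp (measurable_snd.comp (measurable_step hP l h))))
      (measurableSet_singleton s'))
  convert h1 using 1
  ext ω
  simp [and_assoc]

lemma measurable_empTrans (s : S) (a : A) (s' : S) :
    Measurable fun ω => empTrans (P ω) s a s' :=
  (measurable_from_top.comp (measurable_transitionCount hP s a s')).div
    (measurable_from_top.comp (measurable_visits hP s a))

lemma measurable_empReward (s : S) (a : A) : Measurable fun ω => empReward (P ω) s a :=
  (measurable_rewardSum hP s a).div (measurable_from_top.comp (measurable_visits hP s a))

lemma measurable_bonus (L : ℝ) (s : S) (a : A) : Measurable fun ω => bonus L (P ω) s a :=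
  (measurable_from_top (f := fun N : ℕ => (H : ℝ) * transRadius S L N + rewardRadius L N)).comp
    (measurable_visits hP s a)

lemma measurable_optBackup (L : ℝ) {prev : Ω → ℕ → S → A → ℝ}
    (hprev : ∀ n s a, Measurable fun ω => prev ω n s a) (n : ℕ) :
    ∀ s a, Measurable fun ω => optBackup L (prev ω) (P ω) n s a := by
  induction n with
  | zero => intro s a; exact measurable_const
  | succ n ih =>
    intro s a
    exact (hprev (n + 1) s a).min (measurable_const.min (((measurable_empReward hP s a).add
      (measurable_bonus hP L s a)).add (Finset.measurable_sum _ fun s' _ =>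
        (measurable_empTrans hP s a s').mul (Measurable.iSup fun a' => ih s' a'))))

omit hP in
lemma measurable_optQ (L : ℝ) : ∀ {k : ℕ} {P : Ω → Fin k → Record S A H}, Measurable P →
    ∀ n s a, Measurable fun ω => optQ L k (P ω) n s a
  | 0, _, hP, n, s, a => measurable_optBackup hP L (fun _ _ _ => measurable_const) n s a
  | _ + 1, _, hP, n, s, a => measurable_optBackup hP L (measurable_optQ L
      (measurable_pi_lambda _ fun i => measurable_record hP i.castSucc)) n s a

variable {sel : (A → ℝ) → A} (hsel : Measurable sel)

include hsel

lemma measurable_ucbviAction (L : ℝ) (h : ℕ) (s : S) :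
    Measurable fun ω => ucbviAction L sel (P ω) h s :=
  hsel.comp (measurable_pi_lambda _ fun a => measurable_optQ L hP (H - h) s a)

lemma measurable_pessValue (L : ℝ) (n : ℕ) :
    ∀ s, Measurable fun ω => pessValue L (P ω) (ucbviPolicy L sel (P ω)) n s := by
  induction n with
  | zero => intro s; exact measurable_const
  | succ n ih =>
    intro s
    refine measurable_const.max (Finset.measurable_sum _ fun a _ => Measurable.mul ?_
      (((measurable_empReward hP s a).sub (measurable_bonus hP L s a)).add
        (Finset.measurable_sum _ fun s' _ => (measurable_empTrans hP s a s').mul (ih s'))))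
    exact (measurable_of_countable fun b : A => (PMF.pure b a).toReal).comp
      (measurable_ucbviAction hP hsel L (H - (n + 1)) s)

lemma measurable_confidenceGap (L : ℝ) (n : ℕ) (s : S) :
    Measurable fun ω => confidenceGap L sel (P ω) n s :=
  (Measurable.iSup fun a => measurable_optQ L hP n s a).sub (measurable_pessValue hP hsel L n s)

lemma measurableSet_safetyTest (L α : ℝ) (Vb : S → ℝ) {s : Ω → S} (hs : Measurable s) :
    MeasurableSet {ω | safetyTest L α sel Vb k (P ω) (s ω)} := by
  have hV : ∀ {g : Ω → S}, Measurable g → Measurable fun ω => Vb (g ω) := fun hg =>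
    (measurable_of_countable Vb).comp hg
  have hst : ∀ l, Measurable fun ω => Record.start (P ω l) := fun l =>
    measurable_start.comp (measurable_record hP l)
  refine measurableSet_le (measurable_const.mul ((Finset.measurable_sum _ fun l _ =>
    hV (hst l)).add (hV hs))) (Measurable.add (Finset.measurable_sum _ fun l _ => ?_) ?_)
  · refine Measurable.ite ((measurable_explored.comp (measurable_record hP l))
      (measurableSet_singleton true)) ?_ (hV (hst l))
    exact measurable_apply_discrete (f := fun x ω => pessProposal L sel
      (fun i : Fin l.1 => P ω ⟨i.1, i.2.trans l.2⟩) x) (fun x => measurable_pessValue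
        (measurable_pi_lambda _ fun i => measurable_record hP _) hsel L H x) (hst l)
  · exact measurable_apply_discrete (f := fun x ω => pessProposal L sel (P ω) x)
      (fun x => measurable_pessValue hP hsel L H x) hs

end Measurability

/-! ### Measurability of runs, and Ville's inequality along a run -/

section RunMeasurability

variable {S A Ω : Type*} [Fintype S] [MeasurableSpace S] [MeasurableSingletonClass S]
  [Fintype A] [MeasurableSpace A] [MeasurableSingletonClass A] [MeasurableSpace Ω] {H : ℕ}

lemma measurable_rollout {act : Ω → ℕ → StepNoise S A → S → A} {ν : Ω → ℕ → StepNoise S A}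
    {s : Ω → S} (hs : Measurable s) (hν : ∀ h, Measurable fun ω => ν ω h)
    (hact : ∀ h x, Measurable fun ω => act ω h (ν ω h) x) (h : ℕ) :
    Measurable fun ω => rollout (act ω) (ν ω) (s ω) h := by
  induction h with
  | zero => exact hs
  | succ h ih =>
    have ha : Measurable fun ω => act ω h (ν ω h) (rollout (act ω) (ν ω) (s ω) h) :=
      measurable_apply_discrete (f := fun x ω => act ω h (ν ω h) x) (hact h) ih
    exact measurable_apply_discrete (f := fun (q : S × A) ω => ((ν ω h).2 q.1 q.2).2)
      (fun q => measurable_snd.comp ((measurable_pi_apply q.2).comp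
        ((measurable_pi_apply q.1).comp (measurable_snd.comp (hν h))))) (ih.prodMk ha)

lemma measurable_trajectory {act : Ω → ℕ → StepNoise S A → S → A} {ν : Ω → ℕ → StepNoise S A}
    {s : Ω → S} (hs : Measurable s) (hν : ∀ h, Measurable fun ω => ν ω h)
    (hact : ∀ h x, Measurable fun ω => act ω h (ν ω h) x) :
    Measurable fun ω => trajectory H (act ω) (ν ω) (s ω) := by
  refine measurable_pi_lambda _ fun h => ?_
  have hx := measurable_rollout hs hν hact h
  have ha : Measurable fun ω => act ω h (ν ω h) (rollout (act ω) (ν ω) (s ω) h) :=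
    measurable_apply_discrete (f := fun x ω => act ω h (ν ω h) x) (hact h) hx
  refine hx.prodMk (ha.prodMk ?_)
  exact measurable_apply_discrete (f := fun (q : S × A) ω => (ν ω h).2 q.1 q.2)
    (fun q => (measurable_pi_apply q.2).comp
      ((measurable_pi_apply q.1).comp (measurable_snd.comp (hν h)))) (hx.prodMk ha)

variable {Z : Type*} [MeasurableSpace Z] {L : ℝ} {sel : (A → ℝ) → A} (hsel : Measurable sel)
  {rule : (k : ℕ) → (Fin k → Record S A H) → S → Prop}
  (hrule : ∀ k, MeasurableSet {p : (Fin k → Record S A H) × S | rule k p.1 p.2})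
  {start : (k : ℕ) → Z × (Fin k → Record S A H) → S} (hstart : ∀ k, Measurable (start k))

include hsel hrule hstart

lemma measurable_episode (k : ℕ) : Measurable fun p : Z × Noise S A =>
    episode H L sel rule (fun k past => start k (p.1, past)) p.2 k := by
  induction k using Nat.strong_induction_on with
  | _ k ih =>
    have hP : Measurable fun p : Z × Noise S A =>
        history (episode H L sel rule (fun k past => start k (p.1, past)) p.2) k :=
      measurable_pi_lambda _ fun l => ih l l.2
    set P := fun p : Z × Noise S A =>
        history (episode H L sel rule (fun k past => start k (p.1, past)) p.2) k with hPdef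
    have hs : Measurable fun p => start k (p.1, P p) :=
      (hstart k).comp (measurable_fst.prodMk hP)
    have hb : Measurable fun p : Z × Noise S A => decide (rule k (P p) (start k (p.1, P p))) := by
      have : (fun p : Z × Noise S A => decide (rule k (P p) (start k (p.1, P p)))) =
          fun p => if rule k (P p) (start k (p.1, P p)) then true else false := by
        funext p
        by_cases h : rule k (P p) (start k (p.1, P p)) <;> simp [h]
      rw [this]
      exact Measurable.ite ((hrule k).preimage (hP.prodMk hs)) measurable_const measurable_const
    have hν : ∀ h : ℕ, Measurable fun p : Z × Noise S A =>
        p.2 (decide (rule k (P p) (start k (p.1, P p))),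
          countFlag (P p) (decide (rule k (P p) (start k (p.1, P p)))), h) := fun h =>
      measurable_apply_discrete (f := fun (q : Bool × ℕ) (p : Z × Noise S A) => p.2 (q.1, q.2, h))
        (fun q => (measurable_pi_apply _).comp measurable_snd)
        (hb.prodMk (measurable_countFlag hP hb))
    have heq : (fun p : Z × Noise S A =>
        episode H L sel rule (fun k past => start k (p.1, past)) p.2 k) = fun p =>
        ((start k (p.1, P p), decide (rule k (P p) (start k (p.1, P p)))), trajectory H
          (fun h ν x => if decide (rule k (P p) (start k (p.1, P p))) = true then
            ucbviAction L sel (P p) h x else ν.1 x)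
          (fun h => p.2 (decide (rule k (P p) (start k (p.1, P p))),
            countFlag (P p) (decide (rule k (P p) (start k (p.1, P p)))), h))
          (start k (p.1, P p))) := by
      funext p
      exact episode_eq L sel rule (fun k past => start k (p.1, past)) p.2 k
    rw [heq]
    refine (hs.prodMk hb).prodMk (measurable_trajectory hs hν fun h x => ?_)
    exact Measurable.ite (hb (measurableSet_singleton true)) (measurable_ucbviAction hP hsel L h x)
      ((measurable_pi_apply x).comp (measurable_fst.comp (hν h)))

lemma measurable_history (k : ℕ) : Measurable fun p : Z × Noise S A =>
    history (episode H L sel rule (fun k past => start k (p.1, past)) p.2) k :=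
  measurable_pi_lambda _ fun l => measurable_episode hsel hrule hstart l

lemma measurable_explorationTerm
    {f : (k : ℕ) → (Fin k → Record S A H) → Fin H → Transition S A → ℝ}
    (hf : ∀ k h, Measurable fun q : (Fin k → Record S A H) × Transition S A => f k q.1 h q.2)
    (K j : ℕ) (h : Fin H) : Measurable fun p : Z × Noise S A =>
      explorationTerm H L sel rule (fun k past => start k (p.1, past)) f K j h p.2 := by
  refine Finset.measurable_sum _ fun k _ => Measurable.ite ?_ ?_ measurable_const
  · exact ((measurable_explored.comp (measurable_episode hsel hrule hstart k))
      (measurableSet_singleton true)).inter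
      ((measurable_countFlag (measurable_history hsel hrule hstart k) measurable_const)
        (measurableSet_singleton j))
  · exact (hf k h).comp ((measurable_history hsel hrule hstart k).prodMk
      ((measurable_pi_apply h).comp
        (measurable_snd.comp (measurable_episode hsel hrule hstart k))))

/-- Ville's inequality for the non-conservative episodes of a run. -/
theorem measure_explorationSum_ge_le (ζ : Measure Z) [IsProbabilityMeasure ζ] (M : MDP S A)
    (πb : Policy S A) (hH : 0 < H)
    {f : (k : ℕ) → (Fin k → Record S A H) → Fin H → Transition S A → ℝ}
    (hf : ∀ k h, Measurable fun q : (Fin k → Record S A H) × Transition S A => f k q.1 h q.2)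
    (hint : ∀ k past h s a, ∫⁻ y, ENNReal.ofReal (Real.exp (f k past h (s, a, y)))
      ∂((M.rewardLaw s a).prod (M.trans s a).toMeasure) ≤ 1) (K : ℕ) (u : ℝ) :
    (ζ.prod (noiseLaw M πb)) {p | ∃ k ≤ K, u ≤ explorationSum f
        (episode H L sel rule (fun k past => start k (p.1, past)) p.2) k} ≤
      ENNReal.ofReal (Real.exp (-u)) := by
  -- Time `t` stands for step `t % H` of the non-conservative episode number `t / H`, so that usual
  -- order on times is the lexicographic one.
  let F : ℕ → Z × Noise S A → ℝ := fun t p => explorationTerm H L sel rule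
    (fun k past => start k (p.1, past)) f K (t / H) ⟨t % H, Nat.mod_lt _ hH⟩ p.2
  have hsum : ∀ (p : Z × Noise S A) j, ∑ t ∈ Finset.range (j * H), F t p =
      ∑ i ∈ Finset.range j, ∑ h, explorationTerm H L sel rule
        (fun k past => start k (p.1, past)) f K i h p.2 := by
    intro p j
    induction j with
    | zero => simp
    | succ j ih =>
      rw [Nat.succ_mul, Finset.sum_range_add (F · p), ih, Finset.sum_range_succ,
        Finset.sum_range fun x => F (j * H + x) p]
      refine congrArg₂ (· + ·) rfl (Finset.sum_congr rfl fun h _ => ?_)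
      have h1 : (j * H + h.1) / H = j := by
        rw [mul_comm, Nat.mul_add_div hH, Nat.div_eq_of_lt h.2, add_zero]
      have h2 : (j * H + h.1) % H = h.1 := by
        rw [mul_comm, Nat.mul_add_mod, Nat.mod_eq_of_lt h.2]
      simp only [F, h1, h2]
  have hville := measure_exists_le_sum_le_exp (ζ.prod (noiseLaw M πb))
    (fun t => stepLaw M πb (t % H))
    (fun t p x => (p.1, Function.update p.2 (true, t / H, t % H) x))
    (fun t φ hφ => lintegral_prod_infinitePi_update ζ
      (fun i : Bool × ℕ × ℕ => stepLaw M πb i.2.2) (true, t / H, t % H) hφ) F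
    (fun t => measurable_explorationTerm hsel hrule hstart hf K _ _)
    (fun s t hst p x => explorationTerm_update (by
      have h1 := Nat.div_le_div_right (c := H) hst.le
      have h2 := Nat.div_add_mod s H
      have h3 := Nat.div_add_mod t H
      rcases Nat.lt_or_eq_of_le h1 with h | h
      · exact Or.inl h
      · refine Or.inr ⟨h, ?_⟩
        rw [h] at h2
        simp only
        omega) x)
    (fun t p => ?_) u (K * H)
  · refine (measure_mono ?_).trans hville
    rintro p ⟨k, hk, hu⟩
    -- The first `k` episodes correspond to the random time `H` times the number of non-conservative
    -- ones, at most `K * H`; the supremum over times in Ville's inequality absorbs this randomness.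
    refine ⟨countFlag (history (episode H L sel rule (fun k past => start k (p.1, past)) p.2) k)
      true * H, ?_, ?_⟩
    · have := countFlag_true_add_false
        (episode H L sel rule (fun k past => start k (p.1, past)) p.2) k
      exact Nat.mul_le_mul_right _ (by omega)
    · rw [hsum, sum_explorationTerm hk]
      exact hu
  · rcases explorationTerm_update_self (L := L) (sel := sel) (rule := rule)
      (start := fun k past => start k (p.1, past)) (ω := p.2) (f := f) (K := K) (t / H)
      ⟨t % H, Nat.mod_lt _ hH⟩ with h | ⟨k, past, s, a, h⟩
    · simp only [F, h]
      simp
    · simp only [F, h]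
      have hmap : (stepLaw M πb (t % H)).map (fun x => x.2 s a) =
          (M.rewardLaw s a).prod (M.trans s a).toMeasure := by
        have h1 : MeasurePreserving (fun x : StepNoise S A => x.2 s a) (stepLaw M πb (t % H))
            ((M.rewardLaw s a).prod (M.trans s a).toMeasure) :=
          (measurePreserving_eval (fun a => (M.rewardLaw s a).prod (M.trans s a).toMeasure) a).comp
            ((measurePreserving_eval (fun s => Measure.pi fun a =>
              (M.rewardLaw s a).prod (M.trans s a).toMeasure) s).comp measurePreserving_snd)
        exact h1.map_eq
      have hx : Measurable fun x : StepNoise S A => x.2 s a :=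
        (measurable_pi_apply a).comp ((measurable_pi_apply s).comp measurable_snd)
      have hfm : Measurable fun y : ℝ × S => ENNReal.ofReal (Real.exp
          (f k past ⟨t % H, Nat.mod_lt _ hH⟩ (s, a, y))) :=
        (Real.measurable_exp.comp ((hf k _).comp (measurable_const.prodMk
          (measurable_const.prodMk (measurable_const.prodMk measurable_id))))).ennreal_ofReal
      have h2 := hint k past ⟨t % H, Nat.mod_lt _ hH⟩ s a
      rwa [← hmap, lintegral_map hfm hx] at h2

end RunMeasurability

/-! ### Hoeffding increments and the sums they produce -/

/-- Hoeffding's lemma in the form of an exponential supermartingale increment. -/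
lemma lintegral_exp_hoeffding {Ω : Type*} [MeasurableSpace Ω] {μ : Measure Ω}
    [IsProbabilityMeasure μ] {X : Ω → ℝ} (hX : Measurable X) {c : ℝ}
    (hb : ∀ᵐ ω ∂μ, X ω ∈ Set.Icc 0 c) (t : ℝ) :
    ∫⁻ ω, ENNReal.ofReal (Real.exp (t * (X ω - ∫ ω, X ω ∂μ) - t ^ 2 * c ^ 2 / 8)) ∂μ ≤ 1 := by
  have h := ProbabilityTheory.hasSubgaussianMGF_of_mem_Icc hX.aemeasurable hb
  have hint := h.integrable_exp_mul t
  have hmgf := h.mgf_le t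
  simp only [ProbabilityTheory.mgf] at hmgf
  have hc : (((‖c - 0‖₊ / 2) ^ 2 : NNReal) : ℝ) * t ^ 2 / 2 = t ^ 2 * c ^ 2 / 8 := by
    push_cast
    rw [sub_zero, Real.norm_eq_abs, div_pow, sq_abs]
    ring
  rw [hc] at hmgf
  rw [← ofReal_integral_eq_lintegral_ofReal _ (Filter.Eventually.of_forall fun _ =>
    (Real.exp_pos _).le), ← ENNReal.ofReal_one]
  · refine ENNReal.ofReal_le_ofReal ?_
    simp only [Real.exp_sub]
    rw [integral_div, div_le_one (Real.exp_pos _)]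
    exact hmgf
  · simp only [Real.exp_sub]
    exact hint.div_const _

section Data

variable {S A : Type*} [Fintype S] [Fintype A] {H k : ℕ}

/-- The sum of `g` over the rewards and next states observed in `(s, a)`. -/
noncomputable def visitSum (g : ℝ × S → ℝ) (past : Fin k → Record S A H) (s : S) (a : A) : ℝ :=
  ∑ l, ∑ h, if Record.explored (past l) = true ∧
    ((past l).2 h).1 = s ∧ ((past l).2 h).2.1 = a then g ((past l).2 h).2.2 else 0

lemma sum_transitionCount (B : Finset S) (past : Fin k → Record S A H) (s : S) (a : A) :
    ∑ s' ∈ B, (transitionCount past s a s' : ℝ) =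
      visitSum (fun y => if y.2 ∈ B then 1 else 0) past s a := by
  simp only [transitionCount, visitSum, Nat.cast_sum]
  rw [Finset.sum_comm]
  refine Finset.sum_congr rfl fun l _ => ?_
  rw [Finset.sum_comm]
  refine Finset.sum_congr rfl fun h _ => ?_
  by_cases hv : Record.explored (past l) = true ∧
    ((past l).2 h).1 = s ∧ ((past l).2 h).2.1 = a
  · simp [hv.1, hv.2.1, hv.2.2]
  · rw [if_neg hv]
    refine Finset.sum_eq_zero fun s' _ => ?_
    rw [if_neg fun h' => hv ⟨h'.1, h'.2.1, h'.2.2.1⟩]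
    simp

lemma sum_univ_transitionCount (past : Fin k → Record S A H) (s : S) (a : A) :
    ∑ s', (transitionCount past s a s' : ℝ) = visits past s a := by
  rw [sum_transitionCount]
  simp [visitSum, visits]

lemma visitSum_succ (g : ℝ × S → ℝ) (e : ℕ → Record S A H) (k : ℕ) (s : S) (a : A) :
    visitSum g (history e (k + 1)) s a = visitSum g (history e k) s a +
      ∑ h, if Record.explored (e k) = true ∧ ((e k).2 h).1 = s ∧ ((e k).2 h).2.1 = a then
        g ((e k).2 h).2.2 else 0 := by
  simp only [visitSum, Fin.sum_univ_castSucc]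
  rfl

lemma visits_le (e : ℕ → Record S A H) (k : ℕ) (s : S) (a : A) :
    visits (history e k) s a ≤ k * H := by
  rw [visits_eq_sum]
  exact (Finset.sum_le_card_nsmul _ _ H fun l _ => episodeVisits_le _ _ _).trans (by simp)

/-- The exponent of the supermartingale for the deviation of `g` from its mean `m` in `(s, a)`. -/
noncomputable def visitIncrement (g : ℝ × S → ℝ) (m t : ℝ) (s : S) (a : A) (tr : Transition S A) :
    ℝ := if tr.1 = s ∧ tr.2.1 = a then t * (g tr.2.2 - m) - t ^ 2 * 1 ^ 2 / 8 else 0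

/-- The compensator is paid only at visits of `(s, a)`. Once the visit count is prescribed it
becomes deterministic, which allows `t` to be tuned. -/
lemma explorationSum_visitIncrement (g : ℝ × S → ℝ) (m t : ℝ) (s : S) (a : A)
    (e : ℕ → Record S A H) (k : ℕ) :
    explorationSum (fun _ _ _ tr => visitIncrement g m t s a tr) e k =
      t * (visitSum g (history e k) s a - visits (history e k) s a * m) -
        t ^ 2 / 8 * visits (history e k) s a := by
  induction k with
  | zero => simp [explorationSum_zero, visits_zero, visitSum]
  | succ k ih =>
    rw [explorationSum_succ, ih, visitSum_succ, visits_succ]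
    by_cases hexp : Record.explored (e k) = true
    · simp only [episodeVisits, hexp, true_and, if_true, visitIncrement]
      push_cast
      have : ∑ h, (if ((e k).2 h).1 = s ∧ ((e k).2 h).2.1 = a then
          t * (g ((e k).2 h).2.2 - m) - t ^ 2 * 1 ^ 2 / 8 else 0) =
          t * (∑ h, (if ((e k).2 h).1 = s ∧ ((e k).2 h).2.1 = a then g ((e k).2 h).2.2 else 0) -
            (∑ h, if ((e k).2 h).1 = s ∧ ((e k).2 h).2.1 = a then (1 : ℝ) else 0) * m) -
          t ^ 2 / 8 * ∑ h, if ((e k).2 h).1 = s ∧ ((e k).2 h).2.1 = a then (1 : ℝ) else 0 := by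
        rw [Finset.sum_mul, ← Finset.sum_sub_distrib, Finset.mul_sum, Finset.mul_sum,
          ← Finset.sum_sub_distrib]
        refine Finset.sum_congr rfl fun h _ => ?_
        split_ifs <;> ring
      rw [this]
      ring
    · simp [episodeVisits, hexp]

lemma explorationSum_gapNoise (M : MDP S A) (L : ℝ) (sel : (A → ℝ) → A) (t : ℝ)
    (e : ℕ → Record S A M.horizon) (k : ℕ) :
    explorationSum (fun _ past h tr => t * gapNoise M L sel past h tr -
        t ^ 2 * (M.horizon : ℝ) ^ 2 / 8) e k =
      t * explorationSum (fun _ past h tr => gapNoise M L sel past h tr) e k -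
        t ^ 2 * (M.horizon : ℝ) ^ 2 / 8 * (countFlag (history e k) true * M.horizon) := by
  induction k with
  | zero => simp [explorationSum_zero, countFlag_zero]
  | succ k ih =>
    rw [explorationSum_succ, ih, explorationSum_succ, countFlag_succ]
    split_ifs with hexp
    · rw [Finset.sum_sub_distrib, ← Finset.mul_sum]
      simp
      ring
    · simp

end Data

/-! ### Deviation inequalities for the estimates and the gap noise -/

section Concentration

variable {S A Z : Type*} [Fintype S] [MeasurableSpace S] [MeasurableSingletonClass S]
  [Fintype A] [MeasurableSpace A] [MeasurableSingletonClass A] [MeasurableSpace Z]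
  {H : ℕ} {L : ℝ} {sel : (A → ℝ) → A} (hsel : Measurable sel)
  {rule : (k : ℕ) → (Fin k → Record S A H) → S → Prop}
  (hrule : ∀ k, MeasurableSet {p : (Fin k → Record S A H) × S | rule k p.1 p.2})
  {start : (k : ℕ) → Z × (Fin k → Record S A H) → S} (hstart : ∀ k, Measurable (start k))
  (ζ : Measure Z) [IsProbabilityMeasure ζ] (M : MDP S A) (πb : Policy S A) (hH : 0 < H)

include hsel hrule hstart hH

/-- Hoeffding's inequality for the first `n` visits of `(s, a)`. -/
lemma measure_visitSum_deviation_le {g : ℝ × S → ℝ} (hg : Measurable g) (s : S) (a : A)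
    (hb : ∀ᵐ y ∂((M.rewardLaw s a).prod (M.trans s a).toMeasure), g y ∈ Set.Icc (0 : ℝ) 1)
    {σ : ℝ} (hσ : σ ^ 2 = 1) (K n : ℕ) (ε : ℝ) (hε : 0 ≤ ε) :
    (ζ.prod (noiseLaw M πb)) {p | ∃ k ≤ K,
        let past := history (episode H L sel rule (fun k past => start k (p.1, past)) p.2) k
        visits past s a = n ∧ n * ε ≤ σ * (visitSum g past s a -
          n * ∫ y, g y ∂((M.rewardLaw s a).prod (M.trans s a).toMeasure))} ≤
      ENNReal.ofReal (Real.exp (-(2 * n * ε ^ 2))) := by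
  set m := ∫ y, g y ∂((M.rewardLaw s a).prod (M.trans s a).toMeasure) with hm
  -- The slope `4 ε` maximises `t n ε - t² n / 8`, with maximum `2 n ε²`; the sign `σ` selects the
  -- tail.
  refine (measure_mono ?_).trans (measure_explorationSum_ge_le hsel hrule hstart ζ M πb hH
    (L := L) (f := fun _ _ _ tr => visitIncrement g m (4 * ε * σ) s a tr) (fun k h => ?_)
    (fun k past h s' a' => ?_) K (2 * n * ε ^ 2))
  · rintro p ⟨k, hk, hN, hdev⟩
    refine ⟨k, hk, ?_⟩
    rw [explorationSum_visitIncrement, hN]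
    have h1 : (4 * ε * σ) ^ 2 = 16 * ε ^ 2 := by rw [mul_pow, hσ]; ring
    rw [h1]
    have h2 := mul_le_mul_of_nonneg_left hdev (show 0 ≤ 4 * ε by positivity)
    nlinarith [h2]
  · refine Measurable.ite (((measurable_fst.comp measurable_snd) (measurableSet_singleton s)).inter
      ((measurable_fst.comp (measurable_snd.comp measurable_snd)) (measurableSet_singleton a)))
      (((((hg.comp (measurable_snd.comp (measurable_snd.comp measurable_snd))).sub_const
        m).const_mul _)).sub_const _) measurable_const
  · by_cases h : s' = s ∧ a' = a
    · obtain ⟨rfl, rfl⟩ := h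
      simp only [visitIncrement, and_self, if_true]
      exact lintegral_exp_hoeffding hg hb _
    · simp [visitIncrement, h]

end Concentration

section GapConcentration

variable {S A Z : Type*} [Fintype S] [MeasurableSpace S] [MeasurableSingletonClass S]
  [Fintype A] [Nonempty A] [MeasurableSpace A] [MeasurableSingletonClass A] [MeasurableSpace Z]
  (M : MDP S A) {L : ℝ} {sel : (A → ℝ) → A} (hsel : Measurable sel)
  {rule : (k : ℕ) → (Fin k → Record S A M.horizon) → S → Prop}
  (hrule : ∀ k, MeasurableSet {p : (Fin k → Record S A M.horizon) × S | rule k p.1 p.2})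
  {start : (k : ℕ) → Z × (Fin k → Record S A M.horizon) → S} (hstart : ∀ k, Measurable (start k))
  (ζ : Measure Z) [IsProbabilityMeasure ζ] (πb : Policy S A) (hH : 0 < M.horizon)

lemma integral_snd_eq_pmfMean (s : S) (a : A) (f : S → ℝ) :
    ∫ y, f y.2 ∂((M.rewardLaw s a).prod (M.trans s a).toMeasure) = pmfMean (M.trans s a) f := by
  rw [integral_fun_snd, PMF.integral_eq_sum]
  simp [pmfMean]

include hsel hrule hstart hH

/-- The Azuma-Hoeffding inequality for the first `n` non-conservative episodes. -/
lemma measure_gapNoise_deviation_le (hL : 0 ≤ L) (K : ℕ) {n : ℕ} (hn : 0 < n) :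
    (ζ.prod (noiseLaw M πb)) {p | ∃ k ≤ K,
        let e := episode M.horizon L sel rule (fun k past => start k (p.1, past)) p.2
        countFlag (history e k) true = n ∧ M.horizon * Real.sqrt (n * M.horizon * L) ≤
          explorationSum (fun _ past h tr => gapNoise M L sel past h tr) e k} ≤
      ENNReal.ofReal (Real.exp (-(2 * L))) := by
  have hn' : (0 : ℝ) < n := by exact_mod_cast hn
  have hH' : (0 : ℝ) < M.horizon := by exact_mod_cast hH
  set w := Real.sqrt (n * M.horizon) with hw
  have hw0 : 0 < w := Real.sqrt_pos.2 (by positivity)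
  have hw2 : w ^ 2 = n * M.horizon := Real.sq_sqrt (by positivity)
  -- Optimal slope for `n H` increments of range `H` and threshold `H w √L`: the linear term is `4
  -- L` and the compensator `2 L`.
  set t := 4 * Real.sqrt L / (M.horizon * w) with ht
  have ht0 : 0 ≤ t := by positivity
  have hsq : Real.sqrt (n * M.horizon * L) = w * Real.sqrt L := Real.sqrt_mul (by positivity) _
  refine (measure_mono ?_).trans (measure_explorationSum_ge_le hsel hrule hstart ζ M πb hH
    (L := L) (f := fun _ past h tr => t * gapNoise M L sel past h tr - t ^ 2 * (M.horizon : ℝ) ^ 2 / 8)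
    (fun k h => ?_) (fun k past h s a => ?_) K (2 * L))
  · rintro p ⟨k, hk, hN, hdev⟩
    refine ⟨k, hk, ?_⟩
    rw [explorationSum_gapNoise, hN]
    have h2 := mul_le_mul_of_nonneg_left hdev ht0
    have h3 : t * (M.horizon * Real.sqrt (n * M.horizon * L)) = 4 * L := by
      rw [hsq, ht]
      field_simp
      rw [Real.sq_sqrt hL]
    have h4 : t ^ 2 * (M.horizon : ℝ) ^ 2 / 8 * (n * M.horizon) = 2 * L := by
      rw [← hw2, ht]
      field_simp
      rw [Real.sq_sqrt hL]
      ring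
    linarith
  · refine Measurable.sub_const (Measurable.const_mul ?_ t) _
    have hgap : ∀ y, Measurable fun q : (Fin k → Record S A M.horizon) × Transition S A =>
        max 0 (confidenceGap L sel q.1 (M.horizon - (h + 1)) y) := fun y =>
      measurable_const.max (measurable_confidenceGap measurable_fst hsel L _ y)
    refine Measurable.sub ?_ ?_
    · refine measurable_apply_discrete
        (f := fun (sa : S × A) (q : (Fin k → Record S A M.horizon) × Transition S A) =>
          pmfMean (M.trans sa.1 sa.2)
            (fun y => max 0 (confidenceGap L sel q.1 (M.horizon - (h + 1)) y)))
        (g := fun q => (q.2.1, q.2.2.1))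
        (fun sa => Finset.measurable_sum _ fun y _ => (hgap y).const_mul _)
        ((measurable_fst.comp measurable_snd).prodMk
          (measurable_fst.comp (measurable_snd.comp measurable_snd)))
    · exact measurable_apply_discrete
        (f := fun (y : S) (q : (Fin k → Record S A M.horizon) × Transition S A) =>
          max 0 (confidenceGap L sel q.1 (M.horizon - (h + 1)) y))
        (g := fun q => q.2.2.2.2) hgap
        (measurable_snd.comp (measurable_snd.comp (measurable_snd.comp measurable_snd)))
  · set Y : S → ℝ := fun y => max 0 (confidenceGap L sel past (M.horizon - (h + 1)) y) with hY
    -- `gapNoise` is mean minus observation, hence Hoeffding's lemma is applied with slope `-t`.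
    have h1 := lintegral_exp_hoeffding (μ := (M.rewardLaw s a).prod (M.trans s a).toMeasure)
      (X := fun y => Y y.2) ((measurable_of_countable Y).comp measurable_snd) (c := M.horizon)
      (Filter.Eventually.of_forall fun y => ⟨le_max_left _ _, max_le hH'.le
        (confidenceGap_le_horizon L sel past _ y.2)⟩) (-t)
    rw [integral_snd_eq_pmfMean] at h1
    refine (le_of_eq (lintegral_congr fun y => ?_)).trans h1
    simp only [gapNoise]
    rw [neg_sq]
    congr 3
    ring

end GapConcentration

lemma measure_biUnion_le_card_mul {Ω ι : Type*} [MeasurableSpace Ω] (μ : Measure Ω) (s : Finset ι)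
    (E : ι → Set Ω) {x : ℝ} (h : ∀ i ∈ s, μ (E i) ≤ ENNReal.ofReal x) :
    μ (⋃ i ∈ s, E i) ≤ ENNReal.ofReal (s.card * x) := by
  refine (measure_biUnion_finset_le s E).trans ((Finset.sum_le_card_nsmul s _ _ h).trans ?_)
  rw [nsmul_eq_mul, ENNReal.ofReal_mul (Nat.cast_nonneg _), ENNReal.ofReal_natCast]

/-! ### The good event and its probability -/

section GoodRun

variable {S A : Type*} [Fintype S] [Fintype A]

/-- The event on which the regret analysis is deterministic. -/
structure GoodRun (M : MDP S A) (L : ℝ) (sel : (A → ℝ) → A) (e : ℕ → Record S A M.horizon)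
    (K : ℕ) : Prop where
  concentrated : ∀ k ≤ K, Concentrated M L (history e k)
  gapNoise_le : ∀ k ≤ K, explorationSum (fun _ past h tr => gapNoise M L sel past h tr) e k ≤
    M.horizon * Real.sqrt (countFlag (history e k) true * M.horizon * L)

/-- At an unvisited pair the estimate is `0` while the mean lies in `[0, 1]`, and `L ≥ 1` makes the
radius at least `2`; so deviation events are needed only for positive counts. -/
lemma abs_empReward_sub_le {M : MDP S A} {L : ℝ} (hL : 1 ≤ L) {k : ℕ}
    {past : Fin k → Record S A M.horizon} {s : S} {a : A}
    (h : visits past s a ≠ 0 → ∀ σ : ℝ, σ = 1 ∨ σ = -1 →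
      σ * (rewardSum past s a - visits past s a * M.meanReward s a) ≤
        visits past s a * rewardRadius L (visits past s a)) :
    |empReward past s a - M.meanReward s a| ≤ rewardRadius L (visits past s a) := by
  by_cases hN : visits past s a = 0
  · rw [empReward, hN, Nat.cast_zero, div_zero, zero_sub, abs_neg,
      abs_of_nonneg (M.meanReward_nonneg s a), rewardRadius]
    have h1 : 1 ≤ Real.sqrt (L / max 1 ((0 : ℕ) : ℝ)) := by
      rw [Real.one_le_sqrt]
      simpa using hL
    linarith [M.meanReward_le_one s a]
  · have hpos : (0 : ℝ) < visits past s a := by exact_mod_cast Nat.pos_of_ne_zero hN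
    have h1 := h hN 1 (Or.inl rfl)
    have h2 := h hN (-1) (Or.inr rfl)
    rw [empReward, abs_le]
    constructor
    · rw [le_sub_iff_add_le, le_div_iff₀ hpos]
      linarith
    · rw [sub_le_iff_le_add, div_le_iff₀ hpos]
      linarith

/-- At a visited pair both vectors have total mass one, so their `ℓ¹` distance is twice the excess
mass on the set where the empirical one is larger. It suffices to control every subset one-sidedly
at half the radius. At an unvisited pair the distance is `1`, below the radius. -/
lemma sum_abs_empTrans_sub_le {M : MDP S A} {L : ℝ} (hL : 1 ≤ L) {k : ℕ}
    {past : Fin k → Record S A M.horizon} {s : S} {a : A}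
    (h : visits past s a ≠ 0 → ∀ B : Finset S,
      (∑ s' ∈ B, (transitionCount past s a s' : ℝ)) -
        visits past s a * ∑ s' ∈ B, (M.trans s a s').toReal ≤
        visits past s a * (transRadius S L (visits past s a) / 2)) :
    ∑ s', |empTrans past s a s' - (M.trans s a s').toReal| ≤
      transRadius S L (visits past s a) := by
  have hS : (1 : ℝ) ≤ Fintype.card S := by exact_mod_cast Fintype.card_pos_iff.2 ⟨s⟩
  by_cases hN : visits past s a = 0
  · have h1 : ∀ s', |empTrans past s a s' - (M.trans s a s').toReal| = (M.trans s a s').toReal := by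
      intro s'
      rw [empTrans, hN, Nat.cast_zero, div_zero, zero_sub, abs_neg,
        abs_of_nonneg ENNReal.toReal_nonneg]
    rw [Finset.sum_congr rfl fun s' _ => h1 s', pmf_sum_toReal, hN, transRadius, Real.one_le_sqrt]
    simp only [Nat.cast_zero, max_eq_left zero_le_one, div_one]
    nlinarith
  · have hpos : (0 : ℝ) < visits past s a := by exact_mod_cast Nat.pos_of_ne_zero hN
    set B := Finset.univ.filter fun s' => 0 ≤ empTrans past s a s' - (M.trans s a s').toReal
    have hsum : ∑ s', (empTrans past s a s' - (M.trans s a s').toReal) = 0 := by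
      rw [Finset.sum_sub_distrib, pmf_sum_toReal]
      simp only [empTrans]
      rw [← Finset.sum_div, sum_univ_transitionCount, div_self hpos.ne', sub_self]
    have habs : ∀ s', |empTrans past s a s' - (M.trans s a s').toReal| =
        2 * (if 0 ≤ empTrans past s a s' - (M.trans s a s').toReal then
          empTrans past s a s' - (M.trans s a s').toReal else 0) -
        (empTrans past s a s' - (M.trans s a s').toReal) := by
      intro s'
      split_ifs with h0
      · rw [abs_of_nonneg h0]
        ring
      · rw [abs_of_neg (not_le.1 h0)]
        ring
    rw [Finset.sum_congr rfl fun s' _ => habs s', Finset.sum_sub_distrib, hsum, sub_zero,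
      ← Finset.mul_sum, ← Finset.sum_filter, Finset.sum_sub_distrib]
    have h1 := h hN B
    have h2 : ∑ s' ∈ B, empTrans past s a s' =
        (∑ s' ∈ B, (transitionCount past s a s' : ℝ)) / visits past s a := by
      simp only [empTrans]
      rw [Finset.sum_div]
    rw [h2]
    have h3 : (∑ s' ∈ B, (transitionCount past s a s' : ℝ)) / visits past s a ≤
        ∑ s' ∈ B, (M.trans s a s').toReal + transRadius S L (visits past s a) / 2 := by
      rw [div_le_iff₀ hpos]
      linarith
    linarith

end GoodRun

/-- The failure probabilities of the three families of events add up to at most `δ`. -/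
lemma failure_sum_le {K H s a : ℕ} {δ L : ℝ} (hδ : 0 < δ) (hH : 0 < H) (hs : 0 < s) (ha : 0 < a)
    (hL1 : 1 ≤ L) (hL : Real.log (3 * K * H * s * a / δ) ≤ L) :
    (K * H * (s * (a * 2 ^ s)) : ℝ) * Real.exp (-(s * L)) +
      (K * H * (s * (a * 2)) : ℝ) * Real.exp (-(8 * L)) + K * Real.exp (-(2 * L)) ≤ δ := by
  -- For `K = 0` the logarithm is the default value at zero and gives no information, but the left
  -- side vanishes.
  rcases Nat.eq_zero_or_pos K with rfl | hK
  · simpa using hδ.le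
  have hK' : (0 : ℝ) < K := by exact_mod_cast hK
  have hH' : (1 : ℝ) ≤ H := by exact_mod_cast hH
  have hs' : (1 : ℝ) ≤ s := by exact_mod_cast hs
  have ha' : (1 : ℝ) ≤ a := by exact_mod_cast ha
  set x := Real.exp (-L) with hx
  have hx0 : 0 < x := Real.exp_pos _
  have hxhalf : x ≤ 1 / 2 := by
    have h1 : x ≤ Real.exp (-1) := Real.exp_le_exp.2 (by linarith)
    have h2 : Real.exp (-1) < 1 / 2 := by
      have := Real.exp_neg_one_lt_d9
      linarith
    linarith
  have hxδ : 3 * (K * H * s * a) * x ≤ δ := by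
    have h1 : (3 * K * H * s * a / δ : ℝ) ≤ Real.exp L := by
      rw [← Real.log_le_iff_le_exp (by positivity)]
      exact hL
    rw [div_le_iff₀ hδ] at h1
    have h2 : Real.exp L * x = 1 := by rw [hx, ← Real.exp_add]; simp
    calc 3 * (K * H * s * a) * x = (3 * K * H * s * a) * x := by ring
      _ ≤ Real.exp L * δ * x := by gcongr
      _ = δ := by rw [mul_right_comm, h2, one_mul]
  have e1 : Real.exp (-(s * L)) = x ^ s := by rw [hx, ← Real.exp_nat_mul]; ring_nf
  have e2 : Real.exp (-(8 * L)) = x ^ 8 := by rw [hx, ← Real.exp_nat_mul]; norm_num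
  have e3 : Real.exp (-(2 * L)) = x ^ 2 := by rw [hx, ← Real.exp_nat_mul]; norm_num
  -- The `2 ^ s` subsets are absorbed because each costs `x ^ s` and `2 x ≤ 1`.
  have b1 : (2 : ℝ) ^ s * x ^ s ≤ 2 * x := by
    rw [← mul_pow]
    exact pow_le_of_le_one (by positivity) (by linarith) hs.ne'
  have b2 : x ^ 8 ≤ x / 4 := by
    have h3 : x ^ 7 ≤ (1 / 2) ^ 7 := pow_le_pow_left₀ hx0.le hxhalf 7
    have : x ^ 8 = x * x ^ 7 := by ring
    rw [this]
    nlinarith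
  have b3 : x ^ 2 ≤ x / 2 := by nlinarith
  rw [e1, e2, e3]
  set W : ℝ := K * H * s * a with hW
  have hW0 : 0 < W := by positivity
  have hKW : (K : ℝ) ≤ W := by
    have h1 : (1 : ℝ) ≤ H * s * a := by
      have := mul_le_mul hH' hs' zero_le_one (by positivity)
      nlinarith
    calc (K : ℝ) = K * 1 := (mul_one _).symm
      _ ≤ K * (H * s * a) := by gcongr
      _ = W := by rw [hW]; ring
  calc (K * H * (s * (a * 2 ^ s)) : ℝ) * x ^ s + (K * H * (s * (a * 2)) : ℝ) * x ^ 8 + K * x ^ 2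
      = W * (2 ^ s * x ^ s) + 2 * W * x ^ 8 + K * x ^ 2 := by rw [hW]; ring
    -- The shares are `2`, `1/2` and `1/2`; their sum is the `3` inside the logarithm.
    _ ≤ W * (2 * x) + 2 * W * (x / 4) + W * (x / 2) := by gcongr
    _ = 3 * W * x := by ring
    _ ≤ δ := hxδ

section Probability

variable {S A Z : Type*} [Fintype S] [Nonempty S] [MeasurableSpace S] [MeasurableSingletonClass S]
  [Fintype A] [Nonempty A] [MeasurableSpace A] [MeasurableSingletonClass A] [MeasurableSpace Z]

/-- Union bound over the value of the count (visits of a pair, or non-conservative episodes), the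
pair, and the subset of states or the sign. The count must be fixed because slopes depend on it; no
union over episodes is needed, since each event already ranges over all `k ≤ K`. -/
theorem measure_not_goodRun_le (M : MDP S A) {L : ℝ} {sel : (A → ℝ) → A} (hsel : Measurable sel)
    {rule : (k : ℕ) → (Fin k → Record S A M.horizon) → S → Prop}
    (hrule : ∀ k, MeasurableSet {p : (Fin k → Record S A M.horizon) × S | rule k p.1 p.2})
    {start : (k : ℕ) → Z × (Fin k → Record S A M.horizon) → S} (hstart : ∀ k, Measurable (start k))
    (ζ : Measure Z) [IsProbabilityMeasure ζ] (πb : Policy S A) (hH : 0 < M.horizon) {K : ℕ} {δ : ℝ}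
    (hδ : 0 < δ) (hL1 : 1 ≤ L)
    (hL : Real.log (3 * K * M.horizon * Fintype.card S * Fintype.card A / δ) ≤ L) :
    (ζ.prod (noiseLaw M πb)) {p | ¬ GoodRun M L sel
      (episode M.horizon L sel rule (fun k past => start k (p.1, past)) p.2) K} ≤
      ENNReal.ofReal δ := by
  have hL0 : 0 ≤ L := zero_le_one.trans hL1
  let e := fun p : Z × Noise S A =>
    episode M.horizon L sel rule (fun k past => start k (p.1, past)) p.2
  let ET : ℕ × S × A × Finset S → Set (Z × Noise S A) := fun i => {p | ∃ k ≤ K,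
    let past := history (episode M.horizon L sel rule (fun k past => start k (p.1, past)) p.2) k
    visits past i.2.1 i.2.2.1 = i.1 ∧ i.1 * (transRadius S L i.1 / 2) ≤ 1 *
      (visitSum (fun y => if y.2 ∈ i.2.2.2 then 1 else 0) past i.2.1 i.2.2.1 - i.1 *
        ∫ y, (if y.2 ∈ i.2.2.2 then (1 : ℝ) else 0)
          ∂((M.rewardLaw i.2.1 i.2.2.1).prod (M.trans i.2.1 i.2.2.1).toMeasure))}
  let ER : ℕ × S × A × Bool → Set (Z × Noise S A) := fun i => {p | ∃ k ≤ K,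
    let past := history (episode M.horizon L sel rule (fun k past => start k (p.1, past)) p.2) k
    visits past i.2.1 i.2.2.1 = i.1 ∧ i.1 * rewardRadius L i.1 ≤
      (if i.2.2.2 = true then (1 : ℝ) else -1) *
      (visitSum (fun y => y.1) past i.2.1 i.2.2.1 - i.1 *
        ∫ y, y.1 ∂((M.rewardLaw i.2.1 i.2.2.1).prod (M.trans i.2.1 i.2.2.1).toMeasure))}
  let EG : ℕ → Set (Z × Noise S A) := fun n => {p | ∃ k ≤ K,
    let e := episode M.horizon L sel rule (fun k past => start k (p.1, past)) p.2
    countFlag (history e k) true = n ∧ M.horizon * Real.sqrt (n * M.horizon * L) ≤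
      explorationSum (fun _ past h tr => gapNoise M L sel past h tr) e k}
  let IT : Finset (ℕ × S × A × Finset S) := Finset.Icc 1 (K * M.horizon) ×ˢ Finset.univ
  let IR : Finset (ℕ × S × A × Bool) := Finset.Icc 1 (K * M.horizon) ×ˢ Finset.univ
  have hsub : {p | ¬ GoodRun M L sel (e p) K} ⊆
      (⋃ i ∈ IT, ET i) ∪ (⋃ i ∈ IR, ER i) ∪ ⋃ n ∈ Finset.Icc 1 K, EG n := by
    intro p hp
    by_contra hnot
    simp only [Set.mem_union, Set.mem_iUnion, not_or, not_exists] at hnot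
    obtain ⟨⟨hT, hR⟩, hG⟩ := hnot
    have hvis : ∀ k ≤ K, ∀ s a, visits (history (e p) k) s a ≠ 0 →
        visits (history (e p) k) s a ∈ Finset.Icc 1 (K * M.horizon) := fun k hk s a hN =>
      Finset.mem_Icc.2 ⟨Nat.pos_of_ne_zero hN,
        (visits_le _ _ _ _).trans (Nat.mul_le_mul_right _ hk)⟩
    refine hp ⟨fun k hk => ⟨fun s a => abs_empReward_sub_le hL1 fun hN σ hσ => ?_,
      fun s a => sum_abs_empTrans_sub_le hL1 fun hN B => ?_⟩, fun k hk => ?_⟩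
    · have h1 := hR (visits (history (e p) k) s a, s, a, decide (σ = 1))
        (Finset.mem_product.2 ⟨hvis k hk s a hN, Finset.mem_univ _⟩)
      by_contra hlt
      refine h1 ⟨k, hk, rfl, ?_⟩
      have hσ' : (if decide (σ = 1) = true then (1 : ℝ) else -1) = σ := by
        rcases hσ with rfl | rfl <;> norm_num
      have hm : ∫ y, y.1 ∂((M.rewardLaw s a).prod (M.trans s a).toMeasure) = M.meanReward s a := by
        rw [integral_fun_fst fun x : ℝ => x]
        simp [MDP.meanReward]
      simp only [hσ', hm]
      exact (not_le.1 hlt).le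
    · have h1 := hT (visits (history (e p) k) s a, s, a, B)
        (Finset.mem_product.2 ⟨hvis k hk s a hN, Finset.mem_univ _⟩)
      by_contra hlt
      refine h1 ⟨k, hk, rfl, ?_⟩
      have hm := integral_snd_eq_pmfMean M s a (fun s' => if s' ∈ B then (1 : ℝ) else 0)
      have hm' : pmfMean (M.trans s a) (fun s' => if s' ∈ B then (1 : ℝ) else 0) =
          ∑ s' ∈ B, (M.trans s a s').toReal := by
        simp [pmfMean]
      simp only [hm, hm', one_mul]
      rw [← sum_transitionCount]
      exact (not_le.1 hlt).le
    · rcases Nat.eq_zero_or_pos (countFlag (history (e p) k) true) with h0 | hpos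
      · have h1 : explorationSum (fun _ past h tr => gapNoise M L sel past h tr) (e p) k = 0 := by
          refine Finset.sum_eq_zero fun l hl => if_neg fun hexp => ?_
          have := countFlag_mono (e p) true (Nat.succ_le_of_lt (Finset.mem_range.1 hl))
          simp only at this
          rw [Nat.succ_eq_add_one, countFlag_succ, if_pos hexp, h0] at this
          omega
        rw [h1]
        positivity
      · have hle : countFlag (history (e p) k) true ≤ K := by
          have := countFlag_true_add_false (e p) k
          omega
        have h1 := hG _ (Finset.mem_Icc.2 ⟨hpos, hle⟩)
        by_contra hlt
        exact h1 ⟨k, hk, rfl, (not_le.1 hlt).le⟩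
  have hT : (ζ.prod (noiseLaw M πb)) (⋃ i ∈ IT, ET i) ≤
      ENNReal.ofReal (IT.card * Real.exp (-(Fintype.card S * L))) := by
    refine measure_biUnion_le_card_mul _ _ _ fun i hi => ?_
    have hi1 : 1 ≤ i.1 := (Finset.mem_Icc.1 (Finset.mem_product.1 hi).1).1
    have hi1' : (1 : ℝ) ≤ i.1 := by exact_mod_cast hi1
    refine (measure_visitSum_deviation_le hsel hrule hstart ζ M πb hH
      (g := fun y => if y.2 ∈ i.2.2.2 then 1 else 0)
      ((measurable_of_countable fun s' => if s' ∈ i.2.2.2 then (1 : ℝ) else 0).comp measurable_snd)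
      i.2.1 i.2.2.1 (Filter.Eventually.of_forall fun y => ?_) (σ := 1) (by norm_num) K i.1
      (transRadius S L i.1 / 2) (by unfold transRadius; positivity)).trans (le_of_eq ?_)
    · split_ifs <;> simp
    -- Half the transition radius gives exponent `2 n · (2 S L / n) / 4 = S L`.
    · congr 3
      rw [transRadius, max_eq_right hi1', div_pow, Real.sq_sqrt (by positivity)]
      field_simp
  have hR : (ζ.prod (noiseLaw M πb)) (⋃ i ∈ IR, ER i) ≤
      ENNReal.ofReal (IR.card * Real.exp (-(8 * L))) := by
    refine measure_biUnion_le_card_mul _ _ _ fun i hi => ?_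
    have hi1 : 1 ≤ i.1 := (Finset.mem_Icc.1 (Finset.mem_product.1 hi).1).1
    have hi1' : (1 : ℝ) ≤ i.1 := by exact_mod_cast hi1
    refine (measure_visitSum_deviation_le hsel hrule hstart ζ M πb hH
      (g := fun y => y.1) measurable_fst i.2.1 i.2.2.1
      (Measure.quasiMeasurePreserving_fst.ae (M.rewardLaw_support i.2.1 i.2.2.1))
      (by split_ifs <;> norm_num) K i.1
      (rewardRadius L i.1) (by unfold rewardRadius; positivity)).trans (le_of_eq ?_)
    -- The reward radius gives exponent `2 n · 4 L / n = 8 L`.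
    congr 3
    rw [rewardRadius, max_eq_right hi1', mul_pow, Real.sq_sqrt (by positivity)]
    field_simp
    ring
  have hG : (ζ.prod (noiseLaw M πb)) (⋃ n ∈ Finset.Icc 1 K, EG n) ≤
      ENNReal.ofReal ((Finset.Icc 1 K).card * Real.exp (-(2 * L))) :=
    measure_biUnion_le_card_mul _ _ _ fun n hn =>
      measure_gapNoise_deviation_le M hsel hrule hstart ζ πb hH hL0 K (Finset.mem_Icc.1 hn).1
  refine (measure_mono hsub).trans ((measure_union_le _ _).trans
    ((add_le_add ((measure_union_le _ _).trans (add_le_add hT hR)) hG).trans ?_))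
  rw [← ENNReal.ofReal_add (by positivity) (by positivity),
    ← ENNReal.ofReal_add (by positivity) (by positivity)]
  refine ENNReal.ofReal_le_ofReal ?_
  have h1 := failure_sum_le (K := K) hδ hH (Fintype.card_pos (α := S)) (Fintype.card_pos (α := A))
    hL1 hL
  refine le_trans (le_of_eq ?_) h1
  simp only [IT, IR, Finset.card_product, Nat.card_Icc, Finset.card_univ, Fintype.card_prod,
    Fintype.card_finset, Fintype.card_bool]
  push_cast
  simp

end Probability

/-! ### The numerical constants -/

/-- The bound on the total gap of `n` non-conservative episodes is this constant times `√n`; `C`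
bounds the gap before the last step. -/
noncomputable def gapRate (H s a : ℕ) (L C : ℝ) : ℝ :=
  Real.sqrt L * (((2 * H + C) * Real.sqrt (2 * s) + 4) *
    (pigeonholeConst H * Real.sqrt (s * a * H)) + C * Real.sqrt H)

/-- After squaring, the claim is `√H ≥ 4/3`; it fails for `H = 1`, one reason to treat that horizon
separately. -/
lemma pigeonholeConst_le {H : ℕ} (hH : 2 ≤ H) : pigeonholeConst H ≤ 2 * Real.sqrt H := by
  have hH' : (2 : ℝ) ≤ H := by exact_mod_cast hH
  have h0 := Real.sqrt_nonneg (H : ℝ)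
  have h1 : Real.sqrt H ^ 2 = H := Real.sq_sqrt (by positivity)
  have h2 : 4 / 3 ≤ Real.sqrt H := Real.le_sqrt_of_sq_le (by norm_num; linarith)
  have h3 : Real.sqrt (1 + H) ≤ 2 * Real.sqrt H - 1 :=
    Real.sqrt_le_iff.2 ⟨by linarith, by nlinarith⟩
  unfold pigeonholeConst
  linarith

/-- For `H ≥ 2` the crude bound `C = H` on the gap suffices. For `H = 1` it would be too large
(already at `s = a = L = 1`), but there the gap after the only step is zero, so `C = 0` is
available. The summand `4 H²` leaves room for the single episode at which the test fails. -/
lemma gapRate_sq_le {H s a : ℕ} {L C : ℝ} (hs : 0 < s) (ha : 0 < a) (hL : 1 ≤ L)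
    (hC : (2 ≤ H ∧ C = H) ∨ (H = 1 ∧ C = 0)) :
    (H : ℝ) * (gapRate H s a L C ^ 2 + 4 * (H : ℝ) ^ 2) ≤ 16 * (H : ℝ) ^ 3 * L +
      (200 * (H : ℝ) ^ 5 * (s : ℝ) ^ 2 * a + 128 * (H : ℝ) ^ 5 * s * a) * L ^ 2 := by
  have hs' : (1 : ℝ) ≤ s := by exact_mod_cast hs
  have ha' : (1 : ℝ) ≤ a := by exact_mod_cast ha
  have hsa : (1 : ℝ) ≤ s * a := one_le_mul_of_one_le_of_one_le hs' ha'
  have hL2 : L ≤ L ^ 2 := by nlinarith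
  have hL2' : 1 ≤ L ^ 2 := hL.trans hL2
  set q := ((2 * H + C) * Real.sqrt (2 * s) + 4) *
    (pigeonholeConst H * Real.sqrt (s * a * H)) + C * Real.sqrt H with hq
  have hg : gapRate H s a L C ^ 2 = L * q ^ 2 := by
    rw [gapRate, mul_pow, Real.sq_sqrt (by linarith)]
  suffices h : (H : ℝ) * (q ^ 2 + 4 * (H : ℝ) ^ 2) ≤
      200 * (H : ℝ) ^ 5 * (s : ℝ) ^ 2 * a + 128 * (H : ℝ) ^ 5 * s * a by
    rw [hg]
    calc (H : ℝ) * (L * q ^ 2 + 4 * (H : ℝ) ^ 2)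
        ≤ H * (L ^ 2 * q ^ 2 + 4 * (H : ℝ) ^ 2 * L ^ 2) := by
          have h1 : 4 * (H : ℝ) ^ 2 ≤ 4 * (H : ℝ) ^ 2 * L ^ 2 :=
            le_mul_of_one_le_right (by positivity) hL2'
          exact mul_le_mul_of_nonneg_left
            (add_le_add (mul_le_mul_of_nonneg_right hL2 (sq_nonneg q)) h1) (Nat.cast_nonneg _)
      _ = (H * (q ^ 2 + 4 * (H : ℝ) ^ 2)) * L ^ 2 := by ring
      _ ≤ (200 * (H : ℝ) ^ 5 * (s : ℝ) ^ 2 * a + 128 * (H : ℝ) ^ 5 * s * a) * L ^ 2 := by gcongr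
      _ ≤ _ := le_add_of_nonneg_left (by positivity)
  set v := Real.sqrt (2 * s) with hv
  have hv0 : 0 ≤ v := Real.sqrt_nonneg _
  have hv2 : v ^ 2 = 2 * s := Real.sq_sqrt (by positivity)
  have hκ0 : 0 ≤ pigeonholeConst H := by unfold pigeonholeConst; positivity
  rcases hC with ⟨hH, rfl⟩ | ⟨rfl, rfl⟩
  · have hH' : (2 : ℝ) ≤ H := by exact_mod_cast hH
    set w := Real.sqrt H with hw
    have hw0 : 0 ≤ w := Real.sqrt_nonneg _
    have hw2 : w ^ 2 = H := Real.sq_sqrt (by positivity)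
    set u := Real.sqrt (s * a) with hu
    have hu0 : 0 ≤ u := Real.sqrt_nonneg _
    have hu2 : u ^ 2 = s * a := Real.sq_sqrt (by positivity)
    have huw : Real.sqrt (s * a * H) = u * w := Real.sqrt_mul (by positivity) _
    have hq0 : 0 ≤ q := by positivity
    have hqle : q ≤ 6 * H ^ 2 * (u * v) + 8 * H * u + H * w := by
      calc q ≤ ((2 * H + H) * v + 4) * ((2 * w) * (u * w)) + H * w := by
            rw [hq, huw]
            gcongr
            exact pigeonholeConst_le hH
        _ = 6 * H * w ^ 2 * (u * v) + 8 * w ^ 2 * u + H * w := by ring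
        _ = _ := by rw [hw2]; ring
    have hq2 : q ^ 2 ≤ 144 * (H : ℝ) ^ 4 * (s : ℝ) ^ 2 * a + 256 * (H : ℝ) ^ 2 * (s * a) +
        4 * (H : ℝ) ^ 3 := by
      calc q ^ 2 ≤ (6 * H ^ 2 * (u * v) + 8 * H * u + H * w) ^ 2 := pow_le_pow_left₀ hq0 hqle 2
        -- `(x + y + z)² ≤ 2 x² + 4 y² + 4 z²` favours the leading term, whose coefficient becomes
        -- `144`, below `200`.
        _ ≤ 2 * (6 * H ^ 2 * (u * v)) ^ 2 + 4 * (8 * H * u) ^ 2 + 4 * (H * w) ^ 2 := by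
            nlinarith [sq_nonneg (6 * H ^ 2 * (u * v) - (8 * H * u + H * w)),
              sq_nonneg (8 * H * u - H * w)]
        _ = 72 * H ^ 4 * u ^ 2 * v ^ 2 + 256 * H ^ 2 * u ^ 2 + 4 * H ^ 2 * w ^ 2 := by ring
        _ = _ := by rw [hu2, hv2, hw2]; ring
    have p2 : (4 : ℝ) ≤ (H : ℝ) ^ 2 := by nlinarith
    have p3 : 4 * (H : ℝ) ^ 3 ≤ (H : ℝ) ^ 5 := by
      have : (H : ℝ) ^ 5 = H ^ 2 * H ^ 3 := by ring
      rw [this]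
      gcongr
    have p4 : 2 * (H : ℝ) ^ 4 ≤ (H : ℝ) ^ 5 := by
      have : (H : ℝ) ^ 5 = H * H ^ 4 := by ring
      rw [this]
      gcongr
    have p5 : (H : ℝ) ^ 5 ≤ (H : ℝ) ^ 5 * (s * a) := le_mul_of_one_le_right (by positivity) hsa
    have p6 : 4 * (H : ℝ) ^ 3 * (s * a) ≤ (H : ℝ) ^ 5 * (s * a) := by gcongr
    have p8 : 0 ≤ (H : ℝ) ^ 5 * (s * a) := by positivity
    have p7 : 0 ≤ (H : ℝ) ^ 5 * (s : ℝ) ^ 2 * a := by positivity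
    calc (H : ℝ) * (q ^ 2 + 4 * (H : ℝ) ^ 2)
        ≤ H * (144 * (H : ℝ) ^ 4 * (s : ℝ) ^ 2 * a + 256 * (H : ℝ) ^ 2 * (s * a) +
          4 * (H : ℝ) ^ 3 + 4 * (H : ℝ) ^ 2) := by gcongr
      _ = 144 * ((H : ℝ) ^ 5 * (s : ℝ) ^ 2 * a) + 64 * (4 * (H : ℝ) ^ 3 * (s * a)) +
          2 * (2 * (H : ℝ) ^ 4) + 4 * (H : ℝ) ^ 3 := by ring
      _ ≤ 200 * ((H : ℝ) ^ 5 * (s : ℝ) ^ 2 * a) + 128 * ((H : ℝ) ^ 5 * (s * a)) := by linarith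
      _ = _ := by ring
  · have hκ : pigeonholeConst 1 ^ 2 ≤ 6 := by
      have h1 : Real.sqrt 2 ^ 2 = 2 := Real.sq_sqrt (by norm_num)
      have h2 : Real.sqrt 2 ≤ 3 / 2 := Real.sqrt_le_iff.2 ⟨by norm_num, by norm_num⟩
      have h3 : pigeonholeConst 1 = 1 + Real.sqrt 2 := by
        unfold pigeonholeConst
        norm_num
      rw [h3]
      nlinarith
    have hvle : v ≤ 3 / 4 * (s + 1) :=
      Real.sqrt_le_iff.2 ⟨by positivity, by nlinarith [sq_nonneg ((s : ℝ) - 1)]⟩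
    have hq2 : q ^ 2 = (2 * v + 4) ^ 2 * (pigeonholeConst 1 ^ 2 * (s * a)) := by
      rw [hq]
      push_cast
      rw [zero_mul, add_zero, mul_pow, mul_pow, mul_one, mul_one, Real.sq_sqrt (by positivity)]
      ring
    have h1 : (2 * v + 4) ^ 2 ≤ 20 * s + 28 := by
      rw [show (2 * v + 4) ^ 2 = 4 * v ^ 2 + 16 * v + 16 by ring, hv2]
      linarith
    have h2 : q ^ 2 ≤ (20 * s + 28) * (6 * (s * a)) := by
      rw [hq2]
      gcongr
    have h3 : (s : ℝ) * a ≤ s * (s * a) := le_mul_of_one_le_left (by positivity) hs'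
    push_cast
    linarith

/-! ### Deterministic analysis on the good event -/

section Runs

variable {S A : Type*} [Fintype S] [Fintype A] [Nonempty A]

lemma GoodRun.sum_confidenceGap_le {M : MDP S A} {L : ℝ} {sel : (A → ℝ) → A}
    (hmax : ∀ (f : A → ℝ) (a : A), f a ≤ f (sel f)) {e : ℕ → Record S A M.horizon} {K : ℕ}
    (hgood : GoodRun M L sel e K)
    (hg : ∀ l, Record.explored (e l) = true → IsGreedyEpisode L sel e l) {C : ℝ}
    (hC : (2 ≤ M.horizon ∧ C = M.horizon) ∨ (M.horizon = 1 ∧ C = 0)) {k : ℕ} (hk : k ≤ K) :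
    ∑ l ∈ Finset.range k, (if Record.explored (e l) = true then
      confidenceGap L sel (history e l) M.horizon (Record.start (e l)) else 0) ≤
    gapRate M.horizon (Fintype.card S) (Fintype.card A) L C *
      Real.sqrt (countFlag (history e k) true) := by
  have hC0 : 0 ≤ C := by
    rcases hC with ⟨_, rfl⟩ | ⟨_, rfl⟩
    · positivity
    · exact le_rfl
  have hbound : ∀ l < k, ∀ n < M.horizon, ∀ s, confidenceGap L sel (history e l) n s ≤ C := by
    intro l _ n hn s
    rcases hC with ⟨_, rfl⟩ | ⟨h1, rfl⟩
    · exact confidenceGap_le_horizon _ _ _ _ _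
    · obtain rfl : n = 0 := by omega
      rw [confidenceGap_zero]
  have hnoise : explorationSum (fun _ past h tr => gapNoise M L sel past h tr) e k ≤
      C * Real.sqrt (countFlag (history e k) true * M.horizon * L) := by
    rcases hC with ⟨_, rfl⟩ | ⟨h1, rfl⟩
    · exact hgood.gapNoise_le k hk
    -- With one step per episode the noise vanishes identically, since it involves only the gap with
    -- no steps to go.
    · rw [zero_mul]
      refine le_of_eq (Finset.sum_eq_zero fun l _ => ite_eq_right_iff.2 fun _ =>
        Finset.sum_eq_zero fun h _ => ?_)
      have : M.horizon - (h.1 + 1) = 0 := by omega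
      simp [gapNoise, this, confidenceGap_zero, pmfMean_const]
  have h1 := ConservativeRL.sum_confidenceGap_le (fun l _ => hg l)
    (fun j hj => hgood.concentrated j (hj.le.trans hk)) hmax hC0 hbound
  refine h1.trans ((add_le_add_right hnoise _).trans (le_of_eq ?_))
  rw [gapRate, show (Fintype.card S * Fintype.card A * (countFlag (history e k) true * M.horizon)
    : ℝ) = Fintype.card S * Fintype.card A * M.horizon * countFlag (history e k) true by ring,
    show (countFlag (history e k) true * M.horizon * L : ℝ) =
      L * M.horizon * countFlag (history e k) true by ring,
    Real.sqrt_mul (by positivity) (countFlag (history e k) true : ℝ),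
    Real.sqrt_mul' (L * M.horizon) (Nat.cast_nonneg _), Real.sqrt_mul' L (Nat.cast_nonneg _)]
  ring

/-- The rejection at this episode constrains the whole count, because no conservative episode comes
later. -/
lemma exists_last_conservative {H : ℕ} (e : ℕ → Record S A H) (K : ℕ)
    (hK : countFlag (history e K) false ≠ 0) :
    ∃ τ < K, Record.explored (e τ) = false ∧
      countFlag (history e K) false = countFlag (history e τ) false + 1 := by
  induction K with
  | zero => exact absurd (countFlag_zero e false) hK
  | succ K ih =>
    by_cases hexp : Record.explored (e K) = false
    · exact ⟨K, Nat.lt_succ_self K, hexp, by rw [countFlag_succ, if_pos hexp]⟩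
    · have h1 : countFlag (history e (K + 1)) false = countFlag (history e K) false := by
        rw [countFlag_succ, if_neg hexp, add_zero]
      rw [h1] at hK ⊢
      obtain ⟨τ, hτ, h2⟩ := ih hK
      exact ⟨τ, hτ.trans (Nat.lt_succ_self K), h2⟩

/-- The amount credited to an episode by the safety test. -/
noncomputable def credit {H : ℕ} (L : ℝ) (sel : (A → ℝ) → A) (Vb : S → ℝ) (e : ℕ → Record S A H)
    (l : ℕ) : ℝ :=
  if Record.explored (e l) = true then pessProposal L sel (history e l) (Record.start (e l))
  else Vb (Record.start (e l))

lemma safetyTest_iff {H : ℕ} (L α : ℝ) (sel : (A → ℝ) → A) (Vb : S → ℝ) (e : ℕ → Record S A H)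
    (k : ℕ) : safetyTest L α sel Vb k (history e k) (Record.start (e k)) ↔
      (1 - α) * ∑ l ∈ Finset.range (k + 1), Vb (Record.start (e l)) ≤
        ∑ l ∈ Finset.range k, credit L sel Vb e l +
          pessProposal L sel (history e k) (Record.start (e k)) := by
  rw [Finset.sum_range_succ, Finset.sum_range, Finset.sum_range]
  rfl

variable {M : MDP S A} {πb : Policy S A} {L α : ℝ} {sel : (A → ℝ) → A}
  {e : ℕ → Record S A M.horizon} {K : ℕ}

lemma pessProposal_le_value {k : ℕ} (hgood : GoodRun M L sel e K) (hk : k ≤ K) (s : S) :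
    pessProposal L sel (history e k) s ≤ M.value (ucbviPolicy L sel (history e k)) 0 s := by
  have h := pessValue_le_value (hgood.concentrated k hk) (ucbviPolicy L sel (history e k)) le_rfl s
  rwa [Nat.sub_self] at h

/-- The conservative condition holds on the good event. -/
lemma GoodRun.conservative (hgood : GoodRun M L sel e K) (hα0 : 0 < α)
    (hsafe : ∀ k, Record.explored (e k) = true →
      safetyTest L α sel (M.value πb 0) k (history e k) (Record.start (e k)))
    {k : ℕ} (hk : k ≤ K) :
    (1 - α) * ∑ l ∈ Finset.range k, M.value πb 0 (Record.start (e l)) ≤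
      ∑ l ∈ Finset.range k, M.value (executed πb L sel e l) 0 (Record.start (e l)) := by
  -- The credited sums obey the condition surely: an accepted episode restores it by the test, a
  -- conservative one adds `V_b ≥ (1 - α) V_b`. The good event is needed only to pass from credits
  -- to true values.
  have h1 : ∀ k, (1 - α) * ∑ l ∈ Finset.range k, M.value πb 0 (Record.start (e l)) ≤
      ∑ l ∈ Finset.range k, credit L sel (M.value πb 0) e l := by
    intro k
    induction k with
    | zero => simp
    | succ k ih =>
      by_cases hexp : Record.explored (e k) = true
      · have h := (safetyTest_iff L α sel (M.value πb 0) e k).1 (hsafe k hexp)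
        rwa [Finset.sum_range_succ (credit L sel (M.value πb 0) e), credit, if_pos hexp]
      · rw [Finset.sum_range_succ, Finset.sum_range_succ, credit, if_neg hexp, mul_add]
        have h0 := M.value_nonneg πb 0 (Record.start (e k))
        nlinarith
  refine (h1 k).trans (Finset.sum_le_sum fun l hl => ?_)
  rw [Finset.mem_range] at hl
  unfold credit executed
  split_ifs
  · exact pessProposal_le_value hgood (by omega) _
  · exact le_rfl

lemma conservativeCost_nonneg [Nonempty S] (hα0 : 0 < α) (hrb : 0 < M.baselineMin πb) (hL : 0 ≤ L) :
    0 ≤ conservativeCost M πb α L := by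
  have := M.baselineGap_nonneg πb
  unfold conservativeCost
  positivity

/-- On the good event the number of conservative episodes is at most the cost over the horizon. -/
lemma GoodRun.horizon_mul_countFlag_le [Nonempty S] (hgood : GoodRun M L sel e K) (hα0 : 0 < α)
    (hα1 : α < 1) (hL : 1 ≤ L) (hrb : 0 < M.baselineMin πb) (hH : 0 < M.horizon)
    (hmax : ∀ (f : A → ℝ) (a : A), f a ≤ f (sel f))
    (hg : ∀ l, Record.explored (e l) = true → IsGreedyEpisode L sel e l)
    (hreject : ∀ k, Record.explored (e k) = false →
      ¬ safetyTest L α sel (M.value πb 0) k (history e k) (Record.start (e k))) :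
    (M.horizon : ℝ) * countFlag (history e K) false ≤ conservativeCost M πb α L := by
  by_cases hzero : countFlag (history e K) false = 0
  · rw [hzero]
    simpa using conservativeCost_nonneg hα0 hrb (by linarith)
  obtain ⟨τ, hτ, hexp, hcount⟩ := exists_last_conservative e K hzero
  obtain ⟨C, hC⟩ : ∃ C : ℝ, (2 ≤ M.horizon ∧ C = M.horizon) ∨ (M.horizon = 1 ∧ C = 0) := by
    by_cases h : 2 ≤ M.horizon
    · exact ⟨_, Or.inl ⟨h, rfl⟩⟩
    · exact ⟨0, Or.inr ⟨by omega, rfl⟩⟩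
  have hgap := hgood.sum_confidenceGap_le hmax hg hC hτ.le
  have htest := hreject τ hexp
  rw [safetyTest_iff, not_le, Finset.sum_range_succ] at htest
  set rb := M.baselineMin πb with hrbdef
  set D := M.baselineGap πb + α * rb with hD
  set g := gapRate M.horizon (Fintype.card S) (Fintype.card A) L C with hgdef
  set n := countFlag (history e τ) true with hn
  have hΔ := M.baselineGap_nonneg πb
  have hD0 : 0 < D := by positivity
  -- `Δ_b + α r_b ≤ V* - V_b + α V_b ≤ V* ≤ H`; this later turns `4 D H` into `4 H²`.
  have hDH : D ≤ M.horizon := by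
    have s : S := Classical.arbitrary S
    have h1 := M.baselineGap_le πb s
    have h2 := M.baselineMin_le πb s
    have h3 : M.optValue 0 s ≤ M.horizon := M.optValue_le fun π => M.value_le_horizon π _ _
    nlinarith
  -- Shortfall of one episode. If non-conservative, optimism gives `V_b ≤ V* - Δ_b ≤ v̄ - Δ_b`,
  -- leaving the gap minus `D`; if conservative, it is `-α V_b ≤ -α r_b`.
  have hterm : ∀ l ∈ Finset.range τ, (1 - α) * M.value πb 0 (Record.start (e l)) -
      credit L sel (M.value πb 0) e l ≤
      (if Record.explored (e l) = true then
        confidenceGap L sel (history e l) M.horizon (Record.start (e l)) else 0) -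
      D * ((if Record.explored (e l) = true then 1 else 0 : ℕ) : ℝ) -
      α * rb * ((if Record.explored (e l) = false then 1 else 0 : ℕ) : ℝ) := by
    intro l hl
    rw [Finset.mem_range] at hl
    have hb := mul_le_mul_of_nonneg_left (M.baselineMin_le πb (Record.start (e l))) hα0.le
    by_cases hx : Record.explored (e l) = true
    · have h1 : M.optValue 0 (Record.start (e l)) ≤
          optValueEstimate L (history e l) M.horizon (Record.start (e l)) :=
        M.optValue_le fun π => by
          have h := value_le_optValueEstimate (fun j hj => hgood.concentrated j (by omega)) π
            le_rfl (Record.start (e l)) (k := l)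
          rwa [Nat.sub_self] at h
      have h2 := M.baselineGap_le πb (Record.start (e l))
      rw [credit, if_pos hx, if_pos hx, if_pos hx, if_neg (by rw [hx]; simp)]
      rw [confidenceGap, pessProposal]
      push_cast
      linarith
    · have hf : Record.explored (e l) = false := by simpa using hx
      rw [credit, if_neg hx, if_neg hx, if_neg hx, if_pos hf]
      push_cast
      linarith
  have hsum := Finset.sum_le_sum hterm
  rw [Finset.sum_sub_distrib, Finset.sum_sub_distrib, Finset.sum_sub_distrib, ← Finset.mul_sum,
    ← Finset.mul_sum, ← Finset.mul_sum, ← Nat.cast_sum, ← Nat.cast_sum, ← countFlag_eq_sum,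
    ← countFlag_eq_sum, ← hn] at hsum
  have hlast : (1 - α) * M.value πb 0 (Record.start (e τ)) -
      pessProposal L sel (history e τ) (Record.start (e τ)) ≤ M.horizon - α * rb := by
    have h1 := M.value_le_horizon πb 0 (Record.start (e τ))
    have h2 := mul_le_mul_of_nonneg_left (M.baselineMin_le πb (Record.start (e τ))) hα0.le
    have h3 : 0 ≤ pessProposal L sel (history e τ) (Record.start (e τ)) :=
      pessValue_nonneg L (history e τ) _ _ _
    linarith
  -- The failed test makes the total shortfall positive; the `+ 1` is episode `τ` itself, whose
  -- proposal is credited with at least `0`.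
  have hmain : α * rb * (countFlag (history e τ) false + 1) ≤
      g * Real.sqrt n - D * n + M.horizon := by
    linarith
  have hsq : (Real.sqrt n) ^ 2 = n := Real.sq_sqrt (Nat.cast_nonneg _)
  -- Completing the square in `√n` removes the unknown number of non-conservative episodes.
  have hquad : 4 * D * (g * Real.sqrt n - D * n) ≤ g ^ 2 := by
    have h1 : 4 * D * (g * Real.sqrt n - D * n) = g ^ 2 - (g - 2 * D * Real.sqrt n) ^ 2 +
        4 * D ^ 2 * ((Real.sqrt n) ^ 2 - n) := by ring
    rw [h1, hsq]
    linarith [sq_nonneg (g - 2 * D * Real.sqrt n)]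
  have hHpos : (0 : ℝ) < M.horizon := by exact_mod_cast hH
  have hconst := gapRate_sq_le (Fintype.card_pos (α := S)) (Fintype.card_pos (α := A)) hL hC
  rw [← hgdef] at hconst
  have hcost : conservativeCost M πb α L * (4 * α * rb * D) =
      16 * (M.horizon : ℝ) ^ 3 * L +
      (200 * (M.horizon : ℝ) ^ 5 * (Fintype.card S : ℝ) ^ 2 * (Fintype.card A : ℝ) +
        128 * (M.horizon : ℝ) ^ 5 * (Fintype.card S : ℝ) * (Fintype.card A : ℝ)) * L ^ 2 :=
    div_mul_cancel₀ _ (by positivity)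
  rw [hcount]
  refine le_of_mul_le_mul_right ?_ (show 0 < 4 * α * rb * D by positivity)
  rw [hcost]
  refine le_trans ?_ hconst
  calc (M.horizon : ℝ) * ((countFlag (history e τ) false + 1 : ℕ) : ℝ) * (4 * α * rb * D)
      = M.horizon * (4 * D * (α * rb * (countFlag (history e τ) false + 1))) := by push_cast; ring
    _ ≤ M.horizon * (4 * D * (g * Real.sqrt n - D * n + M.horizon)) := by gcongr
    _ = M.horizon * (4 * D * (g * Real.sqrt n - D * n) + 4 * D * M.horizon) := by ring
    _ ≤ M.horizon * (g ^ 2 + 4 * M.horizon * M.horizon) := by gcongr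
    _ = M.horizon * (g ^ 2 + 4 * (M.horizon : ℝ) ^ 2) := by ring

end Runs

end ConservativeRL

theorem mainTheorem3 {S A Z : Type*}
    [Fintype S] [Nonempty S] [MeasurableSpace S] [MeasurableSingletonClass S]
    [Fintype A] [Nonempty A] [MeasurableSpace A] [MeasurableSingletonClass A]
    [MeasurableSpace Z] (ζ : Measure Z) [IsProbabilityMeasure ζ]
    (M : ConservativeRL.MDP S A) (πb : ConservativeRL.Policy S A)
    (K : ℕ) (α δ : ℝ) (hα0 : 0 < α) (hα1 : α < 1) (hδ : 0 < δ)
    (hrb : 0 < M.baselineMin πb)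
    (sel : (A → ℝ) → A) (hsel : Measurable sel) (hmax : ∀ (f : A → ℝ) (a : A), f a ≤ f (sel f))
    (start : (k : ℕ) → Z × (Fin k → ConservativeRL.Record S A M.horizon) → S)
    (hstart : ∀ k, Measurable (start k)) :
    (ζ.prod (ConservativeRL.noiseLaw M πb))
      {ω : Z × ConservativeRL.Noise S A |
        let L : ℝ := ConservativeRL.logTerm M K δ
        let e : ℕ → ConservativeRL.Record S A M.horizon :=
          ConservativeRL.cucbvi M πb L α sel (fun k past => start k (ω.1, past)) ω.2
        ¬ ((∀ x : ℕ → S,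
              (∀ k < K, ConservativeRL.Record.explored (e k) = true →
                x (ConservativeRL.countFlag (fun l : Fin k => e l) true) =
                  ConservativeRL.Record.start (e k)) →
              ConservativeRL.regret M πb L sel e K ≤
                ConservativeRL.regret M πb L sel
                    (ConservativeRL.ucbvi M L sel (fun k _ => x k) ω.2) K +
                  ConservativeRL.conservativeCost M πb α L) ∧
            (ConservativeRL.countFlag (fun l : Fin K => e l) false : ℝ) ≤
              ConservativeRL.conservativeCost M πb α L ∧
            (∀ k, 1 ≤ k → k ≤ K →
              (1 - α) * ∑ l ∈ Finset.range k,
                  M.value πb 0 (ConservativeRL.Record.start (e l)) ≤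
                ∑ l ∈ Finset.range k,
                  M.value (ConservativeRL.executed πb L sel e l) 0
                    (ConservativeRL.Record.start (e l))))}
      ≤ ENNReal.ofReal δ := by
  -- With horizon zero all values vanish, contradicting `r_b > 0`.
  have hH : 0 < M.horizon := by
    rcases Nat.eq_zero_or_pos M.horizon with h | h
    · have h1 := M.baselineMin_le πb (Classical.arbitrary S)
      rw [M.value_of_horizon_le πb h.le] at h1
      exact absurd hrb (not_lt.2 h1)
    · exact h
  have hL1 : 1 ≤ ConservativeRL.logTerm M K δ := le_max_right _ _
  refine (measure_mono ?_).trans (ConservativeRL.measure_not_goodRun_le M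
    (L := ConservativeRL.logTerm M K δ) hsel
    (rule := ConservativeRL.safetyTest (ConservativeRL.logTerm M K δ) α sel (M.value πb 0))
    (fun k => ConservativeRL.measurableSet_safetyTest measurable_fst hsel _ _ _ measurable_snd)
    hstart ζ πb hH (K := K) hδ hL1 (le_max_left _ _))
  intro ω hω hgood
  refine hω ?_
  have hcons := hgood.horizon_mul_countFlag_le hα0 hα1 hL1 hrb hH hmax
    (fun l hl => ConservativeRL.isGreedyEpisode_of_explored hl)
    (fun k hk hsafe => by
      rw [(ConservativeRL.explored_episode ..).2 hsafe] at hk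
      exact absurd hk (by simp))
  refine ⟨fun x hx => ?_, ?_, fun k _ hk => ?_⟩
  · exact (ConservativeRL.regret_le_regret_ucbvi_add M πb _ sel _ _ x ω.2 hx).trans
      (add_le_add_right hcons _)
  -- The cost bounds `H` times the count, so it bounds the count because `H ≥ 1`.
  · refine le_trans (le_mul_of_one_le_left (Nat.cast_nonneg _) ?_) hcons
    exact_mod_cast hH
  · exact hgood.conservative hα0 (fun k hk => (ConservativeRL.explored_episode ..).1 hk) hk
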